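/- Let $F$ be any field (finite or infinite) with $\operatorname{char}(F)\neq 2$, let $UT_2(F)$ be the algebra of $2\times 2$ upper triangular matrices over $F$, and let $\circledast$ be an involution of the first kind on $UT_2(F)$, that is, a map $UT_2(F)\to UT_2(F)$ with $(a+b)^\circledast=a^\circledast+b^\circledast$, $(ab)^\circledast=b^\circledast a^\circledast$ and $(a^\circledast)^\circledast=a$ for all $a,b$, which fixes every element of the center $Z(UT_2(F))$. Let $F\langle X\cup X^*\rangle$ be the free unital associative $F$-algebra on the disjoint countably infinite sets $X=\{x_1,x_2,\dots\}$ and $X^*=\{x_1^*,x_2^*,\dots\}$, with the $F$-linear involution $*$ that interchanges $x_i$ and $x_i^*$ for every $i$. A $*$-endomorphism is an $F$-algebra endomorphism of $F\langle X\cup X^*\rangle$ that commutes with $*$; a $T(*)$-space is a vector subspace of $F\langle X\cup X^*\rangle$ closed under all $*$-endomorphisms; and a $T(*)$-space is finitely generated if it is the intersection of all $T(*)$-spaces containing some finite set $W\subseteq F\langle X\cup X^*\rangle$. Let $Id(UT_2(F),\circledast)$ (respectively $C(UT_2(F),\circledast)$) be the set of all $f(x_1,x_1^*,\dots,x_n,x_n^*)\in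 F\langle X\cup X^*\rangle$ such that $f(a_1,a_1^\circledast,\dots,a_n,a_n^\circledast)=0$ (respectively $\in Z(UT_2(F))$) for all $a_1,\dots,a_n\in UT_2(F)$. Then $C(UT_2(F),\circledast)$ is a finitely generated $T(*)$-space. Moreover, $C(UT_2(F),\circledast)\neq Id(UT_2(F),\circledast)+F$. -/

import Mathlib

namespace StarPoly

/-- A map `σ : A → A` is an involution on the ring `A`: it is additive, reverses products and is
its own inverse. -/
structure IsInvolution {A : Type*} [Ring A] (σ : A → A) : Prop where
  map_add : ∀ a b : A, σ (a + b) = σ a + σ b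
  map_mul : ∀ a b : A, σ (a * b) = σ b * σ a
  involutive : ∀ a : A, σ (σ a) = a

/-- An involution of the first kind: an involution fixing every element of the center. -/
structure IsInvolutionFirstKind {A : Type*} [Ring A] (σ : A → A) : Prop
    extends IsInvolution σ where
  map_center : ∀ a ∈ Set.center A, σ a = a

/-- The algebra of `2 × 2` upper triangular matrices over `F`. -/
abbrev UT2 (F : Type*) [Field F] : Subalgebra F (Matrix (Fin 2) (Fin 2) F) :=
  Matrix.blockTriangularSubalgebra F F (id : Fin 2 → Fin 2)

/-- The free unital associative algebra `F⟨X ∪ X*⟩`; the index `Sum.inl i` stands for the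
variable `x_i` and the index `Sum.inr i` for the variable `x_i*`. -/
abbrev FreeStar (F : Type*) [Field F] : Type _ := FreeAlgebra F (ℕ ⊕ ℕ)

/-- The involution of `F⟨X ∪ X*⟩`: the linear, product reversing map which interchanges `x_i` and
`x_i*`. (It is not Mathlib's `star` on `FreeAlgebra`, which fixes every variable.) -/
noncomputable def freeInvol (F : Type*) [Field F] (f : FreeStar F) : FreeStar F :=
  MulOpposite.unop
    (FreeAlgebra.lift F (fun i : ℕ ⊕ ℕ => MulOpposite.op (FreeAlgebra.ι F i.swap)) f)

theorem freeInvol_x (F : Type*) [Field F] (i : ℕ) :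
    freeInvol F (FreeAlgebra.ι F (Sum.inl i)) = FreeAlgebra.ι F (Sum.inr i) := by
  simp [freeInvol]

theorem freeInvol_xStar (F : Type*) [Field F] (i : ℕ) :
    freeInvol F (FreeAlgebra.ι F (Sum.inr i)) = FreeAlgebra.ι F (Sum.inl i) := by
  simp [freeInvol]

theorem freeInvol_smul (F : Type*) [Field F] (c : F) (f : FreeStar F) :
    freeInvol F (c • f) = c • freeInvol F f := by
  simp [freeInvol]

theorem freeInvol_isInvolution (F : Type*) [Field F] : IsInvolution (freeInvol F) where
  map_add f g := by simp [freeInvol]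
  map_mul f g := by simp [freeInvol]
  involutive f := by
    induction f using FreeAlgebra.induction with
    | grade0 r => simp [freeInvol]
    | grade1 i => simp [freeInvol]
    | mul a b ha hb => simp_all [freeInvol]
    | add a b ha hb => simp_all [freeInvol]

/-- A `*`-endomorphism of `F⟨X ∪ X*⟩`: an algebra endomorphism commuting with the involution. -/
def IsStarEnd {F : Type*} [Field F] (φ : FreeStar F →ₐ[F] FreeStar F) : Prop :=
  ∀ f : FreeStar F, φ (freeInvol F f) = freeInvol F (φ f)

/-- A `T(*)`-space: a vector subspace of `F⟨X ∪ X*⟩` closed under all `*`-endomorphisms. -/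
def IsTStarSpace {F : Type*} [Field F] (V : Submodule F (FreeStar F)) : Prop :=
  ∀ φ : FreeStar F →ₐ[F] FreeStar F, IsStarEnd φ → ∀ f ∈ V, φ f ∈ V

/-- The `T(*)`-space generated by `W`: the intersection of all `T(*)`-spaces containing `W`. -/
noncomputable def tStarSpan {F : Type*} [Field F] (W : Set (FreeStar F)) :
    Submodule F (FreeStar F) :=
  sInf {V | IsTStarSpace V ∧ W ⊆ V}

/-- `V` is a `T(*)`-space which is finitely generated as a `T(*)`-space. -/
def IsFGTStarSpace {F : Type*} [Field F] (V : Submodule F (FreeStar F)) : Prop :=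
  IsTStarSpace V ∧ ∃ W : Set (FreeStar F), W.Finite ∧ V = tStarSpan W

/-- The value `f(a_0, σ a_0, a_1, σ a_1, …)` of a polynomial `f` of `F⟨X ∪ X*⟩`. -/
noncomputable def evalStar {F A : Type*} [Field F] [Ring A] [Algebra F A] (σ : A → A)
    (a : ℕ → A) : FreeStar F →ₐ[F] A :=
  FreeAlgebra.lift F (Sum.elim a (fun i => σ (a i)))

/-- `Id(A, σ)`: the space of all `*`-polynomial identities of `(A, σ)`. -/
noncomputable def starIdentities (F : Type*) {A : Type*} [Field F] [Ring A] [Algebra F A]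
    (σ : A → A) : Submodule F (FreeStar F) where
  carrier := {f | ∀ a : ℕ → A, evalStar σ a f = 0}
  add_mem' {f g} hf hg a := by rw [map_add, hf a, hg a, add_zero]
  zero_mem' a := map_zero _
  smul_mem' c f hf a := by rw [map_smul, hf a, smul_zero]

/-- `C(A, σ)`: the space of all `*`-central polynomials of `(A, σ)`. -/
noncomputable def starCentral (F : Type*) {A : Type*} [Field F] [Ring A] [Algebra F A]
    (σ : A → A) : Submodule F (FreeStar F) where
  carrier := {f | ∀ a : ℕ → A, evalStar σ a f ∈ Subalgebra.center F A}
  add_mem' {f g} hf hg a := by rw [map_add]; exact add_mem (hf a) (hg a)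
  zero_mem' a := by rw [map_zero]; exact zero_mem _
  smul_mem' c f hf a := by rw [map_smul]; exact Subalgebra.smul_mem _ (hf a) c

/-- The scalars `F ⊆ F⟨X ∪ X*⟩`. -/
noncomputable def scalars (F : Type*) [Field F] : Submodule F (FreeStar F) :=
  Submodule.span F {1}

end StarPoly

/-!
Write `A` for `UT₂(F)`. An involution of the first kind interchanges the two diagonal entries, so
`A` has a basis `1`, `h`, `n` in which `h` and `n` multiply like `diag(1, -1)` and `e₁₂`, `h` is
negated and `n` is either fixed or negated (`exists_isTriangularInvolution`). In both cases the
proof has two halves.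

*The identities are generated, as a `T(*)`-ideal, by finitely many of them*, listed in
`plusRelations` and `minusRelations`. Multiplying each by a new variable on either side gives
finitely many generators as a `T(*)`-space. To see that the list suffices, let `B` be the free
algebra modulo the `T(*)`-ideal of the listed identities, with generators `y i = x_i + x_i*` and
`z i = x_i - x_i*`. All fields are treated at once through a number `r` (`IsReducedExponent`) with
`t ^ (2 * r + 1) = t` on `F`: `r = 0` for infinite `F`, and `2 * r + 1` is the order of a finite `F`.
The commutators of generators and the elements `t ^ (2 * r + 1) - t` span an ideal `M` of square
zero with `B ⧸ M` commutative, so that an element of `B` lies in `M` as soon as its values have zero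
diagonal (`IsRadicalSystem.mem_of_apply_eq_zero`). An element of `M` is a combination of the
generators of `M` with coefficients in `B ⧸ M`. Its value is the same combination of multiples of
`n`, but the generators satisfy relations such as `z k * ⁅y i, z j⁆ = z j * ⁅y i, z k⁆`, and their
syzygies have to be controlled. The endomorphism `θ k` which replaces `z k` by zero does this: in
`x - θ k x` every term can be rewritten by these relations as a multiple of a generator involving
`z k`, and then comparing values shows that these multiples vanish. Hence an element with zero
values is unchanged by every `θ k`, and involves only the `y i`, where the claim is immediate.

*The central polynomials are generated by the identities and one or two more polynomials.* If `n` is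
negated, symmetric elements are scalars, so `x + x*` is central, and
`f = (f + f*) / 2 + (f - f*) / 2` with the last term an identity if `f` is central. If `n` is fixed,
the symmetric elements are `α + β n` and the skew ones are `γ h`. With `p` the characteristic, both
`(x + x*) ^ p` (which is `1` for `p = 0`) and `(x₁ - x₁*) * (x₂ - x₂*)` are central. Given a central
`f`, its part involving skew variables has the values of a sum of products of two skew elements
(`exists_skewProducts_sub`). The remaining part in the `y i` alone is central only if the partial
derivatives of the underlying commutative polynomial vanish as functions, and then its values are
combinations of `p`-th powers (`exists_pow_ringChar_of_pderiv`).

The additional central polynomials take both zero and nonzero values, which the sum of an identity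
and a scalar cannot do.
-/

/-! ### Reduced exponents and vanishing polynomial functions -/

namespace StarPoly

/-- The number `r` such that reduced exponents over `F` are those of `t ^ (2 * r + 1) = t`: the
order of `F` is `2 * r + 1` if `F` is finite, and `r = 0` if `F` is infinite. -/
def IsReducedExponent (F : Type*) [Field F] (r : ℕ) : Prop :=
  (Infinite F ∧ r = 0) ∨ (Finite F ∧ Nat.card F = 2 * r + 1)

theorem exists_isReducedExponent {F : Type*} [Field F] (hF : ringChar F ≠ 2) :
    ∃ r, IsReducedExponent F r := by
  rcases finite_or_infinite F with h | h
  · have := Fintype.ofFinite F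
    have h1 := FiniteField.odd_card_of_char_ne_two hF
    refine ⟨Fintype.card F / 2, Or.inr ⟨h, ?_⟩⟩
    rw [Nat.card_eq_fintype_card]
    omega
  · exact ⟨0, Or.inl ⟨h, rfl⟩⟩

theorem IsReducedExponent.pow_eq {F : Type*} [Field F] {r : ℕ} (hr : IsReducedExponent F r)
    (a : F) : a ^ (2 * r + 1) = a := by
  rcases hr with ⟨_, rfl⟩ | ⟨h, hc⟩
  · simp
  · have := Fintype.ofFinite F
    rw [← hc, Nat.card_eq_fintype_card, FiniteField.pow_card]

theorem IsReducedExponent.eq_zero_or {F : Type*} [Field F] {r : ℕ} (hr : IsReducedExponent F r) :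
    r = 0 ∨ (2 * r + 1 : F) = 0 := by
  rcases hr with ⟨_, rfl⟩ | ⟨h, hc⟩
  · simp
  · have := Fintype.ofFinite F
    right
    have := FiniteField.cast_card_eq_zero F
    rw [← Nat.card_eq_fintype_card, hc] at this
    exact_mod_cast this

/-- For `r ≠ 0`, the exponent at most `2 * r` giving the same power as `n` on all `t` with
`t ^ (2 * r + 1) = t`. -/
def reduceExponent (r n : ℕ) : ℕ := if n = 0 then 0 else (n - 1) % (2 * r) + 1

theorem reduceExponent_lt {r : ℕ} (hr : r ≠ 0) (n : ℕ) : reduceExponent r n < 2 * r + 1 := by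
  unfold reduceExponent
  split_ifs
  · omega
  · have := Nat.mod_lt (n - 1) (show 2 * r > 0 by omega)
    omega

theorem pow_reduceExponent {M : Type*} [Monoid M] {r : ℕ} {t : M} (ht : t ^ (2 * r + 1) = t)
    (n : ℕ) : t ^ reduceExponent r n = t ^ n := by
  unfold reduceExponent
  split_ifs with h
  · rw [h]
  · have key : ∀ k a : ℕ, t ^ (a + 2 * r * k + 1) = t ^ (a + 1) := by
      intro k
      induction k with
      | zero => simp
      | succ k ih =>
        intro a
        rw [show a + 2 * r * (k + 1) + 1 = (a + 2 * r * k) + (2 * r + 1) by ring, pow_add, ht,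
          ← pow_succ, ih]
    have := key ((n - 1) / (2 * r)) ((n - 1) % (2 * r))
    rw [Nat.mod_add_div] at this
    rw [← this]
    congr 1
    omega

/-- A polynomial vanishing as a function on `F` vanishes on every tuple of elements of a
commutative algebra whose powers reduce as those of the elements of `F` do. -/
theorem aeval_eq_zero_of_eval_eq_zero {F C ι : Type*} [Field F] [CommRing C] [Algebra F C] {r : ℕ}
    (hr : IsReducedExponent F r) {t : ι → C} (ht : ∀ i, t i ^ (2 * r + 1) = t i)
    (p : MvPolynomial ι F) (hp : ∀ a, MvPolynomial.eval a p = 0) : MvPolynomial.aeval t p = 0 := by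
  by_cases hinf : Infinite F
  · have : p = 0 := MvPolynomial.funext fun a => by simpa using hp a
    simp [this]
  obtain ⟨h, hc⟩ : Finite F ∧ Nat.card F = 2 * r + 1 := by
    rcases hr with ⟨h, _⟩ | h
    · exact absurd h hinf
    · exact h
  have := Fintype.ofFinite F
  rw [Nat.card_eq_fintype_card] at hc
  have hr0 : r ≠ 0 := by
    rintro rfl
    have := Fintype.one_lt_card (α := F)
    omega
  obtain ⟨s, p, rfl⟩ := MvPolynomial.exists_finset_rename p
  set p' : MvPolynomial s F := ∑ m ∈ p.support,
    MvPolynomial.monomial (m.mapRange (reduceExponent r) (by simp [reduceExponent])) (p.coeff m)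
    with hp'
  -- passing to reduced exponents does not change the values
  have key : MvPolynomial.aeval (t ∘ Subtype.val) p' =
      MvPolynomial.aeval (t ∘ Subtype.val) p := by
    conv_rhs => rw [p.as_sum]
    rw [hp', map_sum, map_sum]
    refine Finset.sum_congr rfl fun m _ => ?_
    rw [MvPolynomial.aeval_monomial, MvPolynomial.aeval_monomial,
      Finsupp.prod_mapRange_index (by simp)]
    simp [pow_reduceExponent (ht _)]
  have key2 : ∀ (u : s → F), MvPolynomial.eval u p' = MvPolynomial.eval u p := by
    intro u
    conv_rhs => rw [p.as_sum]
    rw [hp', map_sum, map_sum]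
    refine Finset.sum_congr rfl fun m _ => ?_
    rw [MvPolynomial.eval_monomial, MvPolynomial.eval_monomial,
      Finsupp.prod_mapRange_index (by simp)]
    simp [pow_reduceExponent (hr.pow_eq _)]
  have hzero : p' = 0 := by
    refine MvPolynomial.eq_zero_of_eval_zero_at_prod_finset p' (fun _ => Finset.univ) ?_ ?_
    · intro i
      classical
      rw [Finset.card_univ, hc, MvPolynomial.degreeOf_lt_iff (by omega)]
      intro m hm
      obtain ⟨m', -, hm'⟩ := Finset.mem_biUnion.1 (MvPolynomial.support_sum hm)
      obtain rfl := Finset.mem_singleton.1 (MvPolynomial.support_monomial_subset hm')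
      simpa using reduceExponent_lt hr0 _
    · intro u _
      rw [key2]
      classical
      have := hp (fun i => if h : i ∈ s then u ⟨i, h⟩ else 0)
      rw [MvPolynomial.eval_rename] at this
      rw [← this]
      congr 2
      ext i
      simp
  rw [MvPolynomial.aeval_rename, ← key, hzero, map_zero]

/-- If `X k * p` vanishes as a function on `F`, then the reduction of `p` is killed by
`t k ^ (2 * r)`, an idempotent which is `1` over an infinite field. -/
theorem pow_mul_aeval_eq_zero {F C ι : Type*} [Field F] [CommRing C] [Algebra F C] {r : ℕ}
    (hr : IsReducedExponent F r) {t : ι → C} (ht : ∀ i, t i ^ (2 * r + 1) = t i)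
    (k : ι) (p : MvPolynomial ι F) (hp : ∀ a, a k * MvPolynomial.eval a p = 0) :
    t k ^ (2 * r) * MvPolynomial.aeval t p = 0 := by
  have h := aeval_eq_zero_of_eval_eq_zero hr ht (MvPolynomial.X k * p) (by simpa using hp)
  by_cases hr0 : r = 0
  · subst hr0
    rcases hr with ⟨_, -⟩ | ⟨h1, h2⟩
    · have : MvPolynomial.X k * p = 0 := MvPolynomial.funext fun a => by simpa using hp a
      rcases mul_eq_zero.1 this with h0 | h0
      · exact absurd h0 (MvPolynomial.X_ne_zero k)
      · simp [h0]
    · have := Finite.one_lt_card (α := F)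
      omega
  · rw [show 2 * r = (2 * r - 1) + 1 by omega, pow_succ, mul_assoc]
    rw [map_mul, MvPolynomial.aeval_X] at h
    rw [h, mul_zero]

end StarPoly

/-! ### Algebras commutative modulo an ideal of square zero -/

namespace StarPoly

variable {F B A : Type*} [Field F] [Ring B] [Algebra F B] [Ring A] [Algebra F A]

/-- `B` is generated by the `y i` and `z i`, and the elements of `G` generate an ideal of square
zero modulo which `B` is commutative with generators satisfying `t ^ (2 * r + 1) = t`. The elements
of `G` commute with each `y i` and anticommute with each `z i`. -/
structure IsRadicalSystem (F : Type*) {B : Type*} [Field F] [Ring B] [Algebra F B] (r : ℕ)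
    (y z : ℕ → B) (G : Set B) : Prop where
  adjoin_eq_top : Algebra.adjoin F (Set.range y ∪ Set.range z) = ⊤
  mul_y : ∀ m ∈ G, ∀ i, m * y i = y i * m
  mul_z : ∀ m ∈ G, ∀ i, m * z i = -(z i * m)
  mul_eq_zero : ∀ m ∈ G, ∀ m' ∈ G, m * m' = 0
  yy : ∀ i j, y i * y j - y j * y i ∈ Ideal.span G
  yz : ∀ i j, y i * z j - z j * y i ∈ Ideal.span G
  zz : ∀ i j, z i * z j - z j * z i ∈ Ideal.span G
  y_pow : ∀ i, y i ^ (2 * r + 1) - y i ∈ Ideal.span G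
  z_pow : ∀ i, z i ^ (2 * r + 1) - z i ∈ Ideal.span G

theorem generators_induction {y z : ℕ → B}
    (hgen : Algebra.adjoin F (Set.range y ∪ Set.range z) = ⊤) {p : B → Prop}
    (hy : ∀ i, p (y i)) (hz : ∀ i, p (z i)) (hc : ∀ c : F, p (algebraMap F B c))
    (hadd : ∀ a b, p a → p b → p (a + b)) (hmul : ∀ a b, p a → p b → p (a * b)) (b : B) : p b := by
  have hb : b ∈ Algebra.adjoin F (Set.range y ∪ Set.range z) := hgen ▸ Algebra.mem_top
  induction hb using Algebra.adjoin_induction with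
  | mem x hx =>
    rcases hx with ⟨i, rfl⟩ | ⟨i, rfl⟩
    exacts [hy i, hz i]
  | algebraMap c => exact hc c
  | add a b _ _ ha hb => exact hadd a b ha hb
  | mul a b _ _ ha hb => exact hmul a b ha hb

theorem algHom_ext_of_generators {C : Type*} [Semiring C] [Algebra F C] {y z : ℕ → B}
    (hgen : Algebra.adjoin F (Set.range y ∪ Set.range z) = ⊤) {f g : B →ₐ[F] C}
    (hy : ∀ i, f (y i) = g (y i)) (hz : ∀ i, f (z i) = g (z i)) : f = g := by
  refine AlgHom.ext_of_adjoin_eq_top hgen ?_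
  rintro x (⟨i, rfl⟩ | ⟨i, rfl⟩)
  exacts [hy i, hz i]

namespace IsRadicalSystem

variable {r : ℕ} {y z : ℕ → B} {G : Set B}

/-- Right multiplication on `G` is a twisted left multiplication. -/
theorem exists_twist (h : IsRadicalSystem F r y z G) (b : B) : ∃ b', ∀ m ∈ G, m * b = b' * m := by
  refine generators_induction h.adjoin_eq_top (p := fun b => ∃ b', ∀ m ∈ G, m * b = b' * m)
    (fun i => ⟨y i, fun m hm => h.mul_y m hm i⟩)
    (fun i => ⟨-z i, fun m hm => by rw [h.mul_z m hm i, neg_mul]⟩)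
    (fun c => ⟨algebraMap F B c, fun m _ => (Algebra.commutes c m).symm⟩) ?_ ?_ b
  · rintro a b ⟨a', ha⟩ ⟨b', hb⟩
    exact ⟨a' + b', fun m hm => by rw [mul_add, ha m hm, hb m hm, add_mul]⟩
  · rintro a b ⟨a', ha⟩ ⟨b', hb⟩
    exact ⟨a' * b', fun m hm => by rw [← mul_assoc, ha m hm, mul_assoc, hb m hm, mul_assoc]⟩

theorem mul_mem_right (h : IsRadicalSystem F r y z G) {x : B} (hx : x ∈ Ideal.span G) (b : B) :
    x * b ∈ Ideal.span G := by
  obtain ⟨b', hb⟩ := h.exists_twist b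
  induction hx using Submodule.span_induction with
  | mem m hm => rw [hb m hm]; exact Ideal.mul_mem_left _ _ (Ideal.subset_span hm)
  | zero => simp
  | add x x' _ _ hx hx' => rw [add_mul]; exact add_mem hx hx'
  | smul a x _ hx => rw [smul_eq_mul, mul_assoc]; exact Ideal.mul_mem_left _ _ hx

theorem isTwoSided (h : IsRadicalSystem F r y z G) : (Ideal.span G).IsTwoSided :=
  ⟨fun b hx => h.mul_mem_right hx b⟩

theorem mul_eq_zero_of_mem (h : IsRadicalSystem F r y z G) {x x' : B} (hx : x ∈ Ideal.span G)
    (hx' : x' ∈ Ideal.span G) : x * x' = 0 := by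
  have h1 : ∀ m ∈ G, ∀ x' ∈ Ideal.span G, m * x' = 0 := by
    intro m hm x' hx'
    induction hx' using Submodule.span_induction with
    | mem m' hm' => exact h.mul_eq_zero m hm m' hm'
    | zero => simp
    | add x x' _ _ hx hx' => rw [mul_add, hx, hx', add_zero]
    | smul a x _ hx =>
      obtain ⟨a', ha⟩ := h.exists_twist a
      rw [smul_eq_mul, ← mul_assoc, ha m hm, mul_assoc, hx, mul_zero]
  induction hx using Submodule.span_induction with
  | mem m hm => exact h1 m hm x' hx'
  | zero => simp
  | add x x' _ _ hx hx' => rw [add_mul, hx, hx', add_zero]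
  | smul a x _ hx => rw [smul_eq_mul, mul_assoc, hx, mul_zero]

theorem commutator_mem (h : IsRadicalSystem F r y z G) (b b' : B) :
    b * b' - b' * b ∈ Ideal.span G := by
  have hadd : ∀ c a b : B, c * a - a * c ∈ Ideal.span G → c * b - b * c ∈ Ideal.span G →
      c * (a + b) - (a + b) * c ∈ Ideal.span G := by
    intro c a b ha hb
    rw [show c * (a + b) - (a + b) * c = (c * a - a * c) + (c * b - b * c) by noncomm_ring]
    exact add_mem ha hb
  have hmul : ∀ c a b : B, c * a - a * c ∈ Ideal.span G → c * b - b * c ∈ Ideal.span G →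
      c * (a * b) - a * b * c ∈ Ideal.span G := by
    intro c a b ha hb
    rw [show c * (a * b) - a * b * c = (c * a - a * c) * b + a * (c * b - b * c) by noncomm_ring]
    exact add_mem (h.mul_mem_right ha b) (Ideal.mul_mem_left _ _ hb)
  have hsymm : ∀ {a b : B}, a * b - b * a ∈ Ideal.span G → b * a - a * b ∈ Ideal.span G := by
    intro a b hab
    rw [← neg_sub]
    exact neg_mem hab
  have hgen : ∀ c, (∀ i, c * y i - y i * c ∈ Ideal.span G) →
      (∀ i, c * z i - z i * c ∈ Ideal.span G) → ∀ b, c * b - b * c ∈ Ideal.span G :=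
    fun c hy hz b => generators_induction h.adjoin_eq_top
      (p := fun b => c * b - b * c ∈ Ideal.span G) hy hz
      (fun a => by rw [Algebra.commutes a c, sub_self]; exact zero_mem _) (hadd c) (hmul c) b
  exact hgen b (fun i => hsymm (hgen (y i) (fun j => h.yy i j) (fun j => h.yz i j) b))
    (fun i => hsymm (hgen (z i) (fun j => hsymm (h.yz j i)) (fun j => h.zz i j) b)) b'

/-- The ideal generated by `G` is a module over the commutative ring `B ⧸ Ideal.span G`. -/
theorem mul_left_comm_of_mem (h : IsRadicalSystem F r y z G) (a b : B) {x : B}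
    (hx : x ∈ Ideal.span G) : a * (b * x) = b * (a * x) := by
  have := h.mul_eq_zero_of_mem (h.commutator_mem a b) hx
  rw [sub_mul, sub_eq_zero, mul_assoc, mul_assoc] at this
  exact this

/-- Modulo the ideal generated by `G`, an element is determined by its values under the characters
`χ a c` of `B`. -/
theorem mem_of_apply_eq_zero (h : IsRadicalSystem F r y z G) (hr : IsReducedExponent F r)
    {χ : (ℕ → F) → (ℕ → F) → B →ₐ[F] F} (hy : ∀ a c i, χ a c (y i) = a i)
    (hz : ∀ a c i, χ a c (z i) = c i) (b : B) :
    ((∀ a c, χ a c b = 0) → b ∈ Ideal.span G) ∧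
      ∀ k, (∀ a c, c k * χ a c b = 0) → z k ^ (2 * r) * b ∈ Ideal.span G := by
  have := h.isTwoSided
  let _ : CommRing (B ⧸ Ideal.span G) :=
    { (inferInstance : Ring (B ⧸ Ideal.span G)) with
      mul_comm := by
        intro a b
        obtain ⟨a, rfl⟩ := Ideal.Quotient.mk_surjective a
        obtain ⟨b, rfl⟩ := Ideal.Quotient.mk_surjective b
        rw [← map_mul, ← map_mul, Ideal.Quotient.eq]
        exact h.commutator_mem a b }
  let t : ℕ ⊕ ℕ → B ⧸ Ideal.span G := fun i => Ideal.Quotient.mk _ (Sum.elim y z i)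
  have ht : ∀ i, t i ^ (2 * r + 1) = t i := by
    rintro (i | i)
    · exact Ideal.Quotient.eq.2 (h.y_pow i)
    · exact Ideal.Quotient.eq.2 (h.z_pow i)
  obtain ⟨p, hp1, hp2⟩ : ∃ p : MvPolynomial (ℕ ⊕ ℕ) F,
      MvPolynomial.aeval t p = Ideal.Quotient.mk (Ideal.span G) b ∧
        ∀ a c, χ a c b = MvPolynomial.eval (Sum.elim a c) p := by
    refine generators_induction h.adjoin_eq_top (p := fun b => ∃ p : MvPolynomial (ℕ ⊕ ℕ) F,
      MvPolynomial.aeval t p = Ideal.Quotient.mk (Ideal.span G) b ∧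
        ∀ a c, χ a c b = MvPolynomial.eval (Sum.elim a c) p) ?_ ?_ ?_ ?_ ?_ b
    · exact fun i => ⟨MvPolynomial.X (Sum.inl i), by simp [t], by simp [hy]⟩
    · exact fun i => ⟨MvPolynomial.X (Sum.inr i), by simp [t], by simp [hz]⟩
    · exact fun c => ⟨MvPolynomial.C c, by rw [MvPolynomial.aeval_C]; rfl, by simp⟩
    · rintro a b ⟨p, hp, hp'⟩ ⟨q, hq, hq'⟩
      exact ⟨p + q, by rw [map_add, hp, hq, map_add], fun a c => by simp [hp', hq']⟩
    · rintro a b ⟨p, hp, hp'⟩ ⟨q, hq, hq'⟩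
      exact ⟨p * q, by rw [map_mul, hp, hq, map_mul], fun a c => by simp [hp', hq']⟩
  have hev : ∀ a, ∃ a1 c1, Sum.elim a1 c1 = (a : ℕ ⊕ ℕ → F) := fun a =>
    ⟨a ∘ Sum.inl, a ∘ Sum.inr, Sum.elim_comp_inl_inr a⟩
  refine ⟨fun hb => ?_, fun k hb => ?_⟩
  · rw [← Ideal.Quotient.eq_zero_iff_mem, ← hp1]
    refine aeval_eq_zero_of_eval_eq_zero hr ht p fun a => ?_
    obtain ⟨a, c, rfl⟩ := hev a
    rw [← hp2, hb]
  · rw [← Ideal.Quotient.eq_zero_iff_mem, map_mul, ← hp1, map_pow]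
    refine pow_mul_aeval_eq_zero hr ht (Sum.inr k) p fun a => ?_
    obtain ⟨a, c, rfl⟩ := hev a
    rw [← hp2]
    exact hb a c

end IsRadicalSystem

/-- `θ k` replaces `z k` by zero, and `Θ` replaces every `z k` by zero. -/
structure IsVanishingSystem (y z : ℕ → B) (θ : ℕ → B →ₐ[F] B) (Θ : B →ₐ[F] B) : Prop where
  apply_y : ∀ k i, θ k (y i) = y i
  apply_z : ∀ k i, θ k (z i) = if i = k then 0 else z i
  all_y : ∀ i, Θ (y i) = y i
  all_z : ∀ i, Θ (z i) = 0

/-- An element involves only finitely many of the `z k`. -/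
theorem IsVanishingSystem.all_apply_eq {y z : ℕ → B} {θ : ℕ → B →ₐ[F] B} {Θ : B →ₐ[F] B}
    (h : IsVanishingSystem y z θ Θ)
    (hgen : Algebra.adjoin F (Set.range y ∪ Set.range z) = ⊤) {x : B} (hx : ∀ k, θ k x = x) :
    Θ x = x := by
  let T : ℕ → B →ₐ[F] B := fun n => Nat.rec (AlgHom.id F B) (fun k f => (θ k).comp f) n
  have hT : ∀ n, T (n + 1) = (θ n).comp (T n) := fun n => rfl
  have hTy : ∀ n i, T n (y i) = y i := by
    intro n i
    induction n with
    | zero => rfl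
    | succ n ih => rw [hT, AlgHom.comp_apply, ih, h.apply_y]
  have hTz : ∀ n i, T n (z i) = if i < n then 0 else z i := by
    intro n i
    induction n with
    | zero => rfl
    | succ n ih =>
      rw [hT, AlgHom.comp_apply, ih]
      rcases lt_trichotomy i n with h1 | h1 | h1
      · simp [h1, h1.trans (Nat.lt_succ_self n)]
      · simp [h1, h.apply_z]
      · rw [if_neg (by omega), if_neg (by omega), h.apply_z, if_neg (by omega)]
  have hTx : ∀ n, T n x = x := by
    intro n
    induction n with
    | zero => rfl
    | succ n ih => rw [hT, AlgHom.comp_apply, ih, hx]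
  have hlim : ∀ b, ∃ N, ∀ n ≥ N, T n b = Θ b := by
    refine generators_induction hgen ?_ ?_ ?_ ?_ ?_
    · exact fun i => ⟨0, fun n _ => by rw [hTy, h.all_y]⟩
    · exact fun i => ⟨i + 1, fun n hn => by rw [hTz, h.all_z, if_pos (by omega)]⟩
    · exact fun c => ⟨0, fun n _ => by rw [AlgHom.commutes, AlgHom.commutes]⟩
    · rintro a b ⟨N, hN⟩ ⟨N', hN'⟩
      exact ⟨max N N', fun n hn => by
        rw [map_add, map_add, hN n (le_trans (le_max_left _ _) hn),
          hN' n (le_trans (le_max_right _ _) hn)]⟩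
    · rintro a b ⟨N, hN⟩ ⟨N', hN'⟩
      exact ⟨max N N', fun n hn => by
        rw [map_mul, map_mul, hN n (le_trans (le_max_left _ _) hn),
          hN' n (le_trans (le_max_right _ _) hn)]⟩
  obtain ⟨N, hN⟩ := hlim x
  rw [← hN N le_rfl, hTx]

/-- `1`, `h`, `n` multiply like the identity, `diag(1, -1)` and the matrix unit `e₁₂`, and `χ` is
the character of the upper triangular matrices through which they act on `F e₁₂` from the left. -/
structure IsTriangularBasis (h n : A) (χ : A →ₐ[F] F) : Prop where
  hh : h * h = 1
  hn : h * n = n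
  nh : n * h = -n
  nn : n * n = 0
  ne_zero : n ≠ 0
  mul_n : ∀ x, x * n = χ x • n
  char_h : χ h = 1
  char_n : χ n = 0

end StarPoly

/-! ### The identities and their values in the triangular matrices -/

namespace StarPoly

variable {F B A : Type*} [Field F] [Ring B] [Algebra F B] [Ring A] [Algebra F A]

/-- Identities in symmetric variables `y` and skew variables `z` of the upper triangular matrices
with an involution fixing `e₁₂`. -/
def plusRelations (r : ℕ) {R : Type*} [Ring R] (y z : Fin 4 → R) : List R :=
  let w : Fin 4 → Fin 4 → R := fun i j => y i * z j - z j * y i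
  let u : Fin 4 → R := fun i => y i ^ (2 * r + 1) - y i
  [y 0 * y 1 - y 1 * y 0, z 0 * z 1 - z 1 * z 0, z 0 ^ (2 * r + 1) - z 0,
    w 0 1 * y 2 - y 2 * w 0 1, w 0 1 * z 2 + z 2 * w 0 1, u 0 * z 1 + z 1 * u 0,
    w 0 1 * w 2 3, w 0 1 * u 2, u 2 * w 0 1, u 0 * u 1,
    z 1 * w 0 2 - z 2 * w 0 1, z 1 * u 0 + r * w 0 1, z 1 ^ (2 * r) * w 0 1 - w 0 1]

/-- Identities in symmetric variables `y` and skew variables `z` of the upper triangular matrices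
with an involution negating `e₁₂`. -/
def minusRelations (r : ℕ) {R : Type*} [Ring R] (y z : Fin 4 → R) : List R :=
  let w : Fin 4 → Fin 4 → R := fun i j => z i * z j - z j * z i
  let u : Fin 4 → R := fun i => z i ^ (2 * r + 1) - z i
  [y 0 * y 1 - y 1 * y 0, y 0 * z 1 - z 1 * y 0, y 0 ^ (2 * r + 1) - y 0,
    w 0 1 * z 2 + z 2 * w 0 1, u 0 * z 1 + z 1 * u 0,
    w 0 1 * w 2 3, w 0 1 * u 2, u 2 * w 0 1, u 0 * u 1,
    z 2 * w 0 1 - (z 0 * w 2 1 - z 1 * w 2 0),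
    2 * (z 1 * u 0) - (z 0 ^ (2 * r) - 1) * w 1 0, z 0 * u 0]

/-- An element of the left ideal generated by a family is a combination of the family. -/
theorem exists_finsupp_of_mem_span {ι : Type*} {v : ι → B} {x : B}
    (hx : x ∈ Ideal.span (Set.range v)) : ∃ g : ι →₀ B, g.sum (fun i a => a * v i) = x :=
  (Finsupp.mem_ideal_span_range_iff_exists_finsupp).1 hx

theorem smul_one_add_smul_pow {h n : A} {χ : A →ₐ[F] F} (hb : IsTriangularBasis h n χ) (a b : F)
    (k : ℕ) : (a • (1 : A) + b • n) ^ k = a ^ k • (1 : A) + (k * a ^ (k - 1) * b) • n := by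
  induction k with
  | zero => simp
  | succ k ih =>
    rw [pow_succ, ih]
    rcases k with _ | k
    · simp
    · simp only [add_mul, mul_add, smul_mul_smul_comm, hb.nn, one_mul, mul_one, smul_zero,
        add_zero]
      rw [add_assoc, ← add_smul]
      push_cast
      ring_nf

theorem smul_h_add_smul_n_pow_even {h n : A} {χ : A →ₐ[F] F} (hb : IsTriangularBasis h n χ)
    (a b : F) (r : ℕ) : (a • h + b • n) ^ (2 * r) = a ^ (2 * r) • (1 : A) := by
  have : (a • h + b • n) ^ 2 = a ^ 2 • (1 : A) := by
    rw [sq]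
    simp only [add_mul, mul_add, smul_mul_smul_comm, hb.nn, hb.hh, hb.hn, hb.nh, smul_zero]
    rw [mul_comm b a]
    simp [sq]
  rw [pow_mul, this, smul_pow, one_pow, pow_mul]

theorem IsReducedExponent.cast_mul_pow {r : ℕ} (hr : IsReducedExponent F r) (a : F) :
    (2 * r + 1 : F) * a ^ (2 * r) = 2 * r + 1 := by
  rcases hr.eq_zero_or with rfl | h
  · simp
  · rw [h, zero_mul]

section Values

variable {h n : A} {χ : A →ₐ[F] F}

theorem plus_commutator_value (hb : IsTriangularBasis h n χ) (a b c : F) :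
    (a • (1 : A) + b • n) * (c • h) - (c • h) * (a • (1 : A) + b • n) = (-2 * (b * c)) • n := by
  simp only [add_mul, mul_add, smul_mul_smul_comm, hb.hn, hb.nh, mul_one, one_mul]
  module

theorem plus_power_value (hb : IsTriangularBasis h n χ) {r : ℕ} (hr : IsReducedExponent F r)
    (a b : F) :
    (a • (1 : A) + b • n) ^ (2 * r + 1) - (a • (1 : A) + b • n) = (2 * r * b) • n := by
  rw [smul_one_add_smul_pow hb, hr.pow_eq]
  push_cast
  rw [hr.cast_mul_pow]
  module

theorem minus_commutator_value (hb : IsTriangularBasis h n χ) (a b c d : F) :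
    (a • h + b • n) * (c • h + d • n) - (c • h + d • n) * (a • h + b • n) =
      (2 * (a * d - c * b)) • n := by
  simp only [add_mul, mul_add, smul_mul_smul_comm, hb.hn, hb.nh, hb.hh, hb.nn]
  module

theorem minus_power_value (hb : IsTriangularBasis h n χ) {r : ℕ} (hr : IsReducedExponent F r)
    (a b : F) :
    (a • h + b • n) ^ (2 * r + 1) - (a • h + b • n) = ((a ^ (2 * r) - 1) * b) • n := by
  rw [pow_succ, smul_h_add_smul_n_pow_even hb, smul_mul_assoc, one_mul, smul_add, smul_smul,
    ← pow_succ, hr.pow_eq]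
  module

theorem h_mul_smul (hb : IsTriangularBasis h n χ) (a b c : F) :
    (a • h + b • n) * (c • n) = (a * c) • n := by
  simp only [add_mul, smul_mul_smul_comm, hb.hn, hb.nn, smul_zero, add_zero]

theorem smul_mul_h (hb : IsTriangularBasis h n χ) (a b c : F) :
    (c • n) * (a • h + b • n) = -(a * c) • n := by
  simp only [mul_add, smul_mul_smul_comm, hb.nh, hb.nn, smul_zero, add_zero]
  module

theorem smul_n_mul_smul_n (hb : IsTriangularBasis h n χ) (a b : F) : (a • n) * (b • n) = 0 := by
  rw [smul_mul_smul_comm, hb.nn, smul_zero]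

theorem plusRelations_eq_zero (hb : IsTriangularBasis h n χ) {r : ℕ}
    (hr : IsReducedExponent F r) {y z : Fin 4 → A} (hy : ∀ i, ∃ a b : F, y i = a • (1 : A) + b • n)
    (hz : ∀ i, ∃ c : F, z i = c • h) : ∀ f ∈ plusRelations r y z, f = 0 := by
  choose a b hy using hy
  choose c hz using hz
  have hw : ∀ i j, y i * z j - z j * y i = (-2 * (b i * c j)) • n := fun i j => by
    rw [hy, hz]; exact plus_commutator_value hb _ _ _
  have hu : ∀ i, y i ^ (2 * r + 1) - y i = (2 * r * b i) • n := fun i => by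
    rw [hy]; exact plus_power_value hb hr _ _
  have hzn : ∀ i (d : F), z i * (d • n) = (c i * d) • n := fun i d => by
    rw [hz, smul_mul_smul_comm, hb.hn]
  have hnz : ∀ i (d : F), (d • n) * z i = -(c i * d) • n := fun i d => by
    rw [hz, smul_mul_smul_comm, hb.nh]; module
  have hyn : ∀ i (d : F), y i * (d • n) = (a i * d) • n := fun i d => by
    simp [hy, add_mul, hb.nn, smul_smul, mul_comm d]
  have hny : ∀ i (d : F), (d • n) * y i = (a i * d) • n := fun i d => by
    simp [hy, mul_add, hb.nn, smul_smul]
  have hzp : ∀ i, z i ^ (2 * r) = c i ^ (2 * r) • (1 : A) := fun i => by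
    simpa [hz] using smul_h_add_smul_n_pow_even hb (c i) 0 r
  have hcr : ∀ i, c i ^ (2 * r) * c i = c i := fun i => by rw [← pow_succ, hr.pow_eq]
  have hrn : (r : A) = (r : F) • (1 : A) := by rw [Nat.cast_smul_eq_nsmul, nsmul_one]
  simp only [plusRelations, List.forall_mem_cons, hw, hu, hzn, hnz, hyn, hny, hzp, hrn,
    smul_n_mul_smul_n hb, smul_mul_assoc, one_mul, smul_smul, ← sub_smul, ← add_smul]
  refine ⟨?_, ?_, ?_, ?_, ?_, ?_, trivial, trivial, trivial, trivial, ?_, ?_, ?_, by simp⟩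
  · rw [hy, hy]
    simp only [add_mul, mul_add, smul_mul_smul_comm, hb.nn, one_mul, mul_one]
    module
  · rw [hz, hz, smul_mul_smul_comm, smul_mul_smul_comm, mul_comm, sub_self]
  · rw [pow_succ, hzp, hz, smul_mul_assoc, one_mul, smul_smul, hcr, sub_self]
  · rw [sub_self, zero_smul]
  · rw [neg_add_cancel, zero_smul]
  · rw [neg_add_cancel, zero_smul]
  · convert zero_smul F n using 2; ring
  · convert zero_smul F n using 2; ring
  · convert zero_smul F n using 2
    linear_combination (-2 * b 0) * hcr 1

theorem minusRelations_eq_zero (hb : IsTriangularBasis h n χ) {r : ℕ}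
    (hr : IsReducedExponent F r) {y z : Fin 4 → A} (hy : ∀ i, ∃ a : F, y i = a • (1 : A))
    (hz : ∀ i, ∃ c d : F, z i = c • h + d • n) : ∀ f ∈ minusRelations r y z, f = 0 := by
  choose a hy using hy
  choose c d hz using hz
  have hw : ∀ i j, z i * z j - z j * z i = (2 * (c i * d j - c j * d i)) • n := fun i j => by
    rw [hz, hz]; exact minus_commutator_value hb _ _ _ _
  have hu : ∀ i, z i ^ (2 * r + 1) - z i = ((c i ^ (2 * r) - 1) * d i) • n := fun i => by
    rw [hz]; exact minus_power_value hb hr _ _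
  have hzn : ∀ i (e : F), z i * (e • n) = (c i * e) • n := fun i e => by
    rw [hz, h_mul_smul hb]
  have hnz : ∀ i (e : F), (e • n) * z i = -(c i * e) • n := fun i e => by
    rw [hz, smul_mul_h hb]
  have hzp : ∀ i, z i ^ (2 * r) = c i ^ (2 * r) • (1 : A) := fun i => by
    rw [hz, smul_h_add_smul_n_pow_even hb]
  have hcr : ∀ i, c i ^ (2 * r) * c i = c i := fun i => by rw [← pow_succ, hr.pow_eq]
  have h2 : (2 : A) = (2 : F) • (1 : A) := by rw [two_smul, one_add_one_eq_two]
  simp only [minusRelations, List.forall_mem_cons, hw, hu, hzn, hnz, hzp, h2, sub_mul,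
    smul_n_mul_smul_n hb, smul_mul_assoc, one_mul, smul_smul, ← sub_smul, ← add_smul]
  refine ⟨?_, ?_, ?_, ?_, ?_, trivial, trivial, trivial, trivial, ?_, ?_, ?_, by simp⟩
  · rw [hy, hy, smul_mul_smul_comm, smul_mul_smul_comm, mul_comm, sub_self]
  · rw [hy, smul_mul_assoc, mul_smul_comm, one_mul, mul_one, sub_self]
  · rw [hy, smul_pow, one_pow, hr.pow_eq, sub_self]
  · rw [neg_add_cancel, zero_smul]
  · rw [neg_add_cancel, zero_smul]
  · convert zero_smul F n using 2; ring
  · convert zero_smul F n using 2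
    linear_combination (2 * d 1) * hcr 0
  · convert zero_smul F n using 2
    linear_combination d 0 * hcr 0

end Values

end StarPoly

/-! ### Consequences of the identities for an involution fixing `e₁₂` -/

namespace StarPoly

variable {F B A : Type*} [Field F] [Ring B] [Algebra F B] [Ring A] [Algebra F A]

/-- The consequences of `plusRelations` for all choices of variables, with `⁅y i, z j⁆` and
the power defects `y i ^ (2 * r + 1) - y i` generating the ideal of square zero. -/
structure PlusSystem (r : ℕ) (y z : ℕ → B) : Prop where
  yy : ∀ i j, y i * y j = y j * y i
  zz : ∀ i j, z i * z j = z j * z i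
  z_pow : ∀ i, z i ^ (2 * r + 1) = z i
  wy : ∀ i j k, ⁅y i, z j⁆ * y k = y k * ⁅y i, z j⁆
  wz : ∀ i j k, ⁅y i, z j⁆ * z k = -(z k * ⁅y i, z j⁆)
  uz : ∀ i j, (y i ^ (2 * r + 1) - y i) * z j = -(z j * (y i ^ (2 * r + 1) - y i))
  ww : ∀ i j k l, ⁅y i, z j⁆ * ⁅y k, z l⁆ = 0
  wu : ∀ i j k, ⁅y i, z j⁆ * (y k ^ (2 * r + 1) - y k) = 0
  uw : ∀ i j k, (y k ^ (2 * r + 1) - y k) * ⁅y i, z j⁆ = 0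
  uu : ∀ i j, (y i ^ (2 * r + 1) - y i) * (y j ^ (2 * r + 1) - y j) = 0
  zw : ∀ i j k, z k * ⁅y i, z j⁆ = z j * ⁅y i, z k⁆
  zu : ∀ i k, z k * (y i ^ (2 * r + 1) - y i) = -(r * ⁅y i, z k⁆)
  zzw : ∀ i k, z k ^ (2 * r) * ⁅y i, z k⁆ = ⁅y i, z k⁆

theorem PlusSystem.of_relations {r : ℕ} {y z : ℕ → B}
    (hrel : ∀ s : Fin 4 → ℕ, ∀ f ∈ plusRelations r (y ∘ s) (z ∘ s), f = 0) :
    PlusSystem r y z := by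
  have key := fun i j k l => hrel ![i, j, k, l]
  simp only [plusRelations, List.forall_mem_cons, Function.comp_apply, Matrix.cons_val,
    ← Ring.lie_def] at key
  choose k1 k2 k3 k4 k5 k6 k7 k8 k9 k10 k11 k12 k13 _ using key
  refine ⟨fun i j => ?_, fun i j => ?_, fun i => sub_eq_zero.1 (k3 i 0 0 0),
    fun i j k => sub_eq_zero.1 (k4 i j k 0),
    fun i j k => eq_neg_of_add_eq_zero_left (k5 i j k 0),
    fun i j => eq_neg_of_add_eq_zero_left (k6 i j 0 0), k7, fun i j k => k8 i j k 0,
    fun i j k => k9 i j k 0, fun i j => k10 i j 0 0, fun i j k => sub_eq_zero.1 (k11 i k j 0),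
    fun i k => eq_neg_of_add_eq_zero_left (k12 i k 0 0), fun i k => sub_eq_zero.1 (k13 i k 0 0)⟩
  · have := k1 i j 0 0
    rwa [Ring.lie_def, sub_eq_zero] at this
  · have := k2 i j 0 0
    rwa [Ring.lie_def, sub_eq_zero] at this

/-- The consequences of `minusRelations` for all choices of variables, with `⁅z i, z j⁆` and
the power defects `z i ^ (2 * r + 1) - z i` generating the ideal of square zero. -/
structure MinusSystem (r : ℕ) (y z : ℕ → B) : Prop where
  yy : ∀ i j, y i * y j = y j * y i
  yz : ∀ i j, y i * z j = z j * y i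
  y_pow : ∀ i, y i ^ (2 * r + 1) = y i
  wz : ∀ i j k, ⁅z i, z j⁆ * z k = -(z k * ⁅z i, z j⁆)
  uz : ∀ i j, (z i ^ (2 * r + 1) - z i) * z j = -(z j * (z i ^ (2 * r + 1) - z i))
  ww : ∀ i j k l, ⁅z i, z j⁆ * ⁅z k, z l⁆ = 0
  wu : ∀ i j k, ⁅z i, z j⁆ * (z k ^ (2 * r + 1) - z k) = 0
  uw : ∀ i j k, (z k ^ (2 * r + 1) - z k) * ⁅z i, z j⁆ = 0
  uu : ∀ i j, (z i ^ (2 * r + 1) - z i) * (z j ^ (2 * r + 1) - z j) = 0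
  zw : ∀ i j k, z k * ⁅z i, z j⁆ = z i * ⁅z k, z j⁆ - z j * ⁅z k, z i⁆
  zu : ∀ i k, 2 * (z k * (z i ^ (2 * r + 1) - z i)) = (z i ^ (2 * r) - 1) * ⁅z k, z i⁆
  zu_self : ∀ i, z i * (z i ^ (2 * r + 1) - z i) = 0

theorem MinusSystem.of_relations {r : ℕ} {y z : ℕ → B}
    (hrel : ∀ s : Fin 4 → ℕ, ∀ f ∈ minusRelations r (y ∘ s) (z ∘ s), f = 0) :
    MinusSystem r y z := by
  have key := fun i j k l => hrel ![i, j, k, l]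
  simp only [minusRelations, List.forall_mem_cons, Function.comp_apply, Matrix.cons_val,
    ← Ring.lie_def] at key
  choose k1 k2 k3 k5 k6 k7 k8 k9 k10 k11 k12 k13 _ using key
  refine ⟨fun i j => ?_, fun i j => ?_, fun i => sub_eq_zero.1 (k3 i 0 0 0),
    fun i j k => eq_neg_of_add_eq_zero_left (k5 i j k 0),
    fun i j => eq_neg_of_add_eq_zero_left (k6 i j 0 0), k7, fun i j k => k8 i j k 0,
    fun i j k => k9 i j k 0, fun i j => k10 i j 0 0, fun i j k => sub_eq_zero.1 (k11 i j k 0),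
    fun i k => sub_eq_zero.1 (k12 i k 0 0), fun i => k13 i 0 0 0⟩
  · have := k1 i j 0 0
    rwa [Ring.lie_def, sub_eq_zero] at this
  · have := k2 i j 0 0
    rwa [Ring.lie_def, sub_eq_zero] at this

variable {h n : A} {χ : A →ₐ[F] F} {r : ℕ} {y z : ℕ → B}

theorem PlusSystem.isRadicalSystem (hs : PlusSystem r y z)
    (hgen : Algebra.adjoin F (Set.range y ∪ Set.range z) = ⊤) :
    IsRadicalSystem F r y z
      (Set.range (fun p : ℕ × ℕ => ⁅y p.1, z p.2⁆) ∪
        Set.range (fun i => y i ^ (2 * r + 1) - y i)) where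
  adjoin_eq_top := hgen
  mul_y := by
    rintro _ (⟨p, rfl⟩ | ⟨i, rfl⟩) k
    · exact hs.wy _ _ _
    · exact ((Commute.pow_left (hs.yy i k) _).sub_left (hs.yy i k)).eq
  mul_z := by
    rintro _ (⟨p, rfl⟩ | ⟨i, rfl⟩) k
    · exact hs.wz _ _ _
    · exact hs.uz _ _
  mul_eq_zero := by
    rintro _ (⟨p, rfl⟩ | ⟨i, rfl⟩) _ (⟨p', rfl⟩ | ⟨i', rfl⟩)
    exacts [hs.ww _ _ _ _, hs.wu _ _ _, hs.uw _ _ _, hs.uu _ _]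
  yy i j := by rw [hs.yy, sub_self]; exact zero_mem _
  yz i j := Ideal.subset_span (Or.inl ⟨(i, j), rfl⟩)
  zz i j := by rw [hs.zz, sub_self]; exact zero_mem _
  y_pow i := Ideal.subset_span (Or.inr ⟨i, rfl⟩)
  z_pow i := by rw [hs.z_pow, sub_self]; exact zero_mem _

theorem MinusSystem.isRadicalSystem (hs : MinusSystem r y z)
    (hgen : Algebra.adjoin F (Set.range y ∪ Set.range z) = ⊤) :
    IsRadicalSystem F r y z
      (Set.range (fun p : ℕ × ℕ => ⁅z p.1, z p.2⁆) ∪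
        Set.range (fun i => z i ^ (2 * r + 1) - z i)) where
  adjoin_eq_top := hgen
  mul_y := by
    have hc : ∀ i k, Commute (z i) (y k) := fun i k => (hs.yz k i).symm
    rintro _ (⟨p, rfl⟩ | ⟨i, rfl⟩) k
    · exact (((hc _ k).mul_left (hc _ k)).sub_left ((hc _ k).mul_left (hc _ k))).eq
    · exact ((Commute.pow_left (hc i k) _).sub_left (hc i k)).eq
  mul_z := by
    rintro _ (⟨p, rfl⟩ | ⟨i, rfl⟩) k
    · exact hs.wz _ _ _
    · exact hs.uz _ _
  mul_eq_zero := by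
    rintro _ (⟨p, rfl⟩ | ⟨i, rfl⟩) _ (⟨p', rfl⟩ | ⟨i', rfl⟩)
    exacts [hs.ww _ _ _ _, hs.wu _ _ _, hs.uw _ _ _, hs.uu _ _]
  yy i j := by rw [hs.yy, sub_self]; exact zero_mem _
  yz i j := by rw [hs.yz, sub_self]; exact zero_mem _
  zz i j := Ideal.subset_span (Or.inl ⟨(i, j), rfl⟩)
  y_pow i := by rw [hs.y_pow, sub_self]; exact zero_mem _
  z_pow i := Ideal.subset_span (Or.inr ⟨i, rfl⟩)

/-- If `z k * m` lies in a left ideal `J` below `Ideal.span G`, then so does `(x - θ k x) * m`,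
since `x - θ k x` lies in the ideal generated by `z k`. -/
theorem IsRadicalSystem.sub_apply_mul_mem {G : Set B} (hG : IsRadicalSystem F r y z G)
    {θ : ℕ → B →ₐ[F] B} {Θ : B →ₐ[F] B} (hθ : IsVanishingSystem y z θ Θ) {J : Ideal B} (k : ℕ)
    {m : B} (hm : m ∈ Ideal.span G) (hmJ : z k * m ∈ J) (x : B) : (x - θ k x) * m ∈ J := by
  refine generators_induction hG.adjoin_eq_top (p := fun x => (x - θ k x) * m ∈ J)
    ?_ ?_ ?_ ?_ ?_ x
  · intro i
    simp [hθ.apply_y]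
  · intro i
    rw [hθ.apply_z]
    split_ifs with hi
    · rwa [hi, sub_zero]
    · simp
  · intro c
    simp
  · intro a b ha hb
    rw [map_add, add_sub_add_comm, add_mul]
    exact add_mem ha hb
  · intro a b ha hb
    rw [map_mul, show (a * b - θ k a * θ k b) * m =
      a * ((b - θ k b) * m) + (a - θ k a) * (θ k b * m) by noncomm_ring,
      hG.mul_left_comm_of_mem (a - θ k a) (θ k b) hm]
    exact add_mem (Ideal.mul_mem_left _ _ hb) (Ideal.mul_mem_left _ _ ha)

/-- Over the relations in `plusRelations`, an element vanishing under all substitutions into the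
triangular matrices is zero. -/
theorem PlusSystem.eq_zero_of_apply_eq_zero (hs : PlusSystem r y z)
    (hgen : Algebra.adjoin F (Set.range y ∪ Set.range z) = ⊤) (hF : ringChar F ≠ 2)
    (hr : IsReducedExponent F r) (hb : IsTriangularBasis h n χ)
    {θ : ℕ → B →ₐ[F] B} {Θ : B →ₐ[F] B} (hθ : IsVanishingSystem y z θ Θ)
    {φ : (ℕ → F) → (ℕ → F) → (ℕ → F) → B →ₐ[F] A}
    (hy : ∀ a b c i, φ a b c (y i) = a i • (1 : A) + b i • n)
    (hz : ∀ a b c i, φ a b c (z i) = c i • h) {x : B} (hx : ∀ a b c, φ a b c x = 0) : x = 0 := by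
  have h2 : (2 : F) ≠ 0 := Ring.two_ne_zero hF
  have hG := hs.isRadicalSystem hgen
  set G := Set.range (fun p : ℕ × ℕ => ⁅y p.1, z p.2⁆) ∪
    Set.range (fun i => y i ^ (2 * r + 1) - y i)
  have hwG : ∀ i k, ⁅y i, z k⁆ ∈ Ideal.span G := fun i k =>
    Ideal.subset_span (Or.inl ⟨(i, k), rfl⟩)
  have huG : ∀ i, y i ^ (2 * r + 1) - y i ∈ Ideal.span G := fun i =>
    Ideal.subset_span (Or.inr ⟨i, rfl⟩)
  -- the character of a value does not depend on the nilpotent parts of the substitution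
  have hχ : ∀ a b c g, χ (φ a b c g) = χ (φ a 0 c g) := by
    intro a b c g
    refine DFunLike.congr_fun (f := χ.comp (φ a b c)) (g := χ.comp (φ a 0 c))
      (algHom_ext_of_generators hgen (fun i => ?_) (fun i => ?_)) g
    · simp [hy, hb.char_n]
    · simp [hz]
  have hkey := fun g => hG.mem_of_apply_eq_zero hr (χ := fun a c => χ.comp (φ a 0 c))
    (fun a c i => by simp [hy]) (fun a c i => by simp [hz, hb.char_h]) g
  have hφw : ∀ a b c i k, φ a b c ⁅y i, z k⁆ = (-2 * (b i * c k)) • n := by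
    intro a b c i k
    rw [Ring.lie_def, map_sub, map_mul, map_mul, hy, hz]
    exact plus_commutator_value hb _ _ _
  have hφu : ∀ a b c i, φ a b c (y i ^ (2 * r + 1) - y i) = (2 * r * b i) • n := by
    intro a b c i
    rw [map_sub, map_pow, hy]
    exact plus_power_value hb hr _ _
  have hφθ : ∀ k a b c g, φ a b c (θ k g) = φ a b (Function.update c k 0) g := by
    intro k a b c g
    refine DFunLike.congr_fun (f := (φ a b c).comp (θ k)) (g := φ a b (Function.update c k 0))
      (algHom_ext_of_generators hgen (fun i => ?_) (fun i => ?_)) g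
    · simp [hy, hθ.apply_y]
    · by_cases hi : i = k
      · simp [hz, hθ.apply_z, hi]
      · simp [hz, hθ.apply_z, hi]
  have hφΘ : ∀ a b c g, φ a b c (Θ g) = φ a b 0 g := by
    intro a b c g
    refine DFunLike.congr_fun (f := (φ a b c).comp Θ) (g := φ a b 0)
      (algHom_ext_of_generators hgen (fun i => ?_) (fun i => ?_)) g
    · simp [hy, hθ.all_y]
    · simp [hz, hθ.all_z]
  have hxG : x ∈ Ideal.span G := (hkey x).1 fun a c => by simp [hx]
  -- the terms of `x` involving `z k` collect in multiples of the `⁅y i, z k⁆`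
  have hstep : ∀ k, θ k x = x := by
    intro k
    have hmem : x - θ k x ∈ Ideal.span (Set.range fun i => ⁅y i, z k⁆) := by
      have hw : ∀ i, ⁅y i, z k⁆ ∈ Ideal.span (Set.range fun i => ⁅y i, z k⁆) := fun i =>
        Ideal.subset_span ⟨i, rfl⟩
      clear hx
      induction hxG using Submodule.span_induction with
      | zero => simp
      | add x x' _ _ hx hx' => rw [map_add, add_sub_add_comm]; exact add_mem hx hx'
      | smul g x hx' hx =>
        rw [smul_eq_mul, map_mul, show g * x - θ k g * θ k x =
          (g - θ k g) * x + θ k g * (x - θ k x) by noncomm_ring]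
        refine add_mem (hG.sub_apply_mul_mem hθ k hx' ?_ g) (Ideal.mul_mem_left _ _ hx)
        have hzx : ∀ x ∈ Ideal.span G, z k * x ∈ Ideal.span (Set.range fun i => ⁅y i, z k⁆) := by
          intro x hx
          induction hx using Submodule.span_induction with
          | zero => simp
          | add x x' _ _ hx hx' => rw [mul_add]; exact add_mem hx hx'
          | smul g x hx' hx =>
            rw [smul_eq_mul, hG.mul_left_comm_of_mem _ _ hx']
            exact Ideal.mul_mem_left _ _ hx
          | mem m hm =>
            rcases hm with ⟨⟨i, j⟩, rfl⟩ | ⟨i, rfl⟩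
            · change z k * ⁅y i, z j⁆ ∈ _
              rw [hs.zw]
              exact Ideal.mul_mem_left _ _ (hw i)
            · change z k * (y i ^ (2 * r + 1) - y i) ∈ _
              rw [hs.zu]
              exact neg_mem (Ideal.mul_mem_left _ _ (hw i))
        exact hzx x hx'
      | mem m hm =>
        rcases hm with ⟨⟨i, j⟩, rfl⟩ | ⟨i, rfl⟩
        · change ⁅y i, z j⁆ - θ k ⁅y i, z j⁆ ∈ _
          rw [Ring.lie_def, map_sub, map_mul, map_mul, hθ.apply_y, hθ.apply_z]
          split_ifs with hj
          · rw [hj, mul_zero, zero_mul, sub_zero, sub_zero]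
            exact hw i
          · simp
        · simp [hθ.apply_y]
    obtain ⟨g, hg⟩ := exists_finsupp_of_mem_span hmem
    have hval : ∀ a b c : ℕ → F, ∑ i ∈ g.support, (χ (φ a 0 c (g i)) * (-2 * (b i * c k))) • n = 0 := by
      intro a b c
      have h0 : φ a b c (x - θ k x) = 0 := by rw [map_sub, hφθ, hx, hx, sub_zero]
      rw [← hg, Finsupp.sum, map_sum] at h0
      rw [← h0]
      refine Finset.sum_congr rfl fun i _ => ?_
      rw [map_mul, hφw, mul_smul_comm, hb.mul_n, hχ a b c, smul_smul, mul_comm]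
    have hgk : ∀ i, g i * ⁅y i, z k⁆ = 0 := by
      intro i
      have h1 : ∀ a c, c k * χ (φ a 0 c (g i)) = 0 := by
        intro a c
        by_cases hi : i ∈ g.support
        · have h3 := hval a (Pi.single i 1) c
          rw [Finset.sum_eq_single i (fun j _ hj => by simp [Pi.single_eq_of_ne hj])
            (fun hi' => absurd hi hi'), smul_eq_zero_iff_left hb.ne_zero, Pi.single_eq_same] at h3
          have h4 : (-2 : F) * (c k * χ (φ a 0 c (g i))) = 0 := by linear_combination h3
          exact (mul_eq_zero.1 h4).resolve_left (neg_ne_zero.2 h2)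
        · simp [Finsupp.notMem_support_iff.1 hi]
      have h3 := hG.mul_eq_zero_of_mem ((hkey (g i)).2 k h1) (hwG i k)
      rw [mul_assoc, hG.mul_left_comm_of_mem _ _ (hwG i k), hs.zzw] at h3
      exact h3
    rw [Finsupp.sum, Finset.sum_eq_zero fun i _ => hgk i] at hg
    exact (sub_eq_zero.1 hg.symm).symm
  have hΘ := hθ.all_apply_eq hgen hstep
  -- only the `y i` are left, and with them the multiples of their power defects
  have hmem : x ∈ Ideal.span (Set.range fun i => y i ^ (2 * r + 1) - y i) := by
    rw [← hΘ]
    clear hx hstep hΘ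
    induction hxG using Submodule.span_induction with
    | zero => simp
    | add x x' _ _ hx hx' => rw [map_add]; exact add_mem hx hx'
    | smul g x _ hx => rw [smul_eq_mul, map_mul]; exact Ideal.mul_mem_left _ _ hx
    | mem m hm =>
      rcases hm with ⟨⟨i, j⟩, rfl⟩ | ⟨i, rfl⟩
      · simp [Ring.lie_def, hθ.all_z]
      · refine Ideal.subset_span ⟨i, ?_⟩
        simp [hθ.all_y]
  obtain ⟨g, hg⟩ := exists_finsupp_of_mem_span hmem
  rcases hr.eq_zero_or with rfl | hr0
  · rw [← hg]
    simp
  have hr2 : (2 * r : F) ≠ 0 := by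
    intro h0
    rw [h0, zero_add] at hr0
    exact one_ne_zero hr0
  have hval : ∀ a b : ℕ → F, ∑ i ∈ g.support, (χ (φ a 0 0 (g i)) * (2 * r * b i)) • n = 0 := by
    intro a b
    rw [← hx a b 0, ← hg, Finsupp.sum, map_sum]
    refine Finset.sum_congr rfl fun i _ => ?_
    rw [map_mul, hφu, mul_smul_comm, hb.mul_n, hχ a b 0, smul_smul, mul_comm]
  have hgk : ∀ i, Θ (g i) ∈ Ideal.span G := by
    intro i
    refine (hkey (Θ (g i))).1 fun a c => ?_
    rw [AlgHom.comp_apply, hφΘ]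
    by_cases hi : i ∈ g.support
    · have h3 := hval a (Pi.single i 1)
      rw [Finset.sum_eq_single i (fun j _ hj => by simp [Pi.single_eq_of_ne hj])
        (fun hi' => absurd hi hi'), smul_eq_zero_iff_left hb.ne_zero, Pi.single_eq_same,
        mul_one] at h3
      exact (mul_eq_zero.1 h3).resolve_right hr2
    · simp [Finsupp.notMem_support_iff.1 hi]
  rw [← hΘ, ← hg, Finsupp.sum, map_sum]
  refine Finset.sum_eq_zero fun i _ => ?_
  rw [map_mul, show Θ (y i ^ (2 * r + 1) - y i) = y i ^ (2 * r + 1) - y i by simp [hθ.all_y]]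
  exact hG.mul_eq_zero_of_mem (hgk i) (huG i)

end StarPoly

/-! ### Consequences of the identities for an involution negating `e₁₂` -/

namespace StarPoly

variable {F B A : Type*} [Field F] [Ring B] [Algebra F B] [Ring A] [Algebra F A]
  {h n : A} {χ : A →ₐ[F] F} {r : ℕ} {y z : ℕ → B}

/-- Over the relations in `minusRelations`, an element vanishing under all substitutions into the
triangular matrices is zero. -/
theorem MinusSystem.eq_zero_of_apply_eq_zero (hs : MinusSystem r y z)
    (hgen : Algebra.adjoin F (Set.range y ∪ Set.range z) = ⊤) (hF : ringChar F ≠ 2)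
    (hr : IsReducedExponent F r) (hb : IsTriangularBasis h n χ)
    {θ : ℕ → B →ₐ[F] B} {Θ : B →ₐ[F] B} (hθ : IsVanishingSystem y z θ Θ)
    {φ : (ℕ → F) → (ℕ → F) → (ℕ → F) → B →ₐ[F] A}
    (hy : ∀ a b c i, φ a b c (y i) = a i • (1 : A))
    (hz : ∀ a b c i, φ a b c (z i) = c i • h + b i • n) {x : B}
    (hx : ∀ a b c, φ a b c x = 0) : x = 0 := by
  have h2 : (2 : F) ≠ 0 := Ring.two_ne_zero hF
  have hG := hs.isRadicalSystem hgen
  set G := Set.range (fun p : ℕ × ℕ => ⁅z p.1, z p.2⁆) ∪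
    Set.range (fun i => z i ^ (2 * r + 1) - z i)
  have hskew : ∀ i k, ⁅z i, z k⁆ = -⁅z k, z i⁆ := fun i k => by simp [Ring.lie_def]
  have hwG : ∀ i k, ⁅z i, z k⁆ ∈ Ideal.span G := fun i k =>
    Ideal.subset_span (Or.inl ⟨(i, k), rfl⟩)
  have huG : ∀ i, z i ^ (2 * r + 1) - z i ∈ Ideal.span G := fun i =>
    Ideal.subset_span (Or.inr ⟨i, rfl⟩)
  -- the relation between `⁅z k, z i⁆` and the power defects, with `2` cancelled
  have hzu : ∀ i k, z k * (z i ^ (2 * r + 1) - z i) =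
      algebraMap F B (1 / 2) * ((z i ^ (2 * r) - 1) * ⁅z k, z i⁆) := by
    intro i k
    have hc : algebraMap F B (1 / 2) * 2 = 1 := by
      rw [← map_ofNat (algebraMap F B) 2, ← map_mul, one_div, inv_mul_cancel₀ h2, map_one]
    rw [← hs.zu, ← mul_assoc (algebraMap F B _), hc, one_mul]
  -- the character of a value does not depend on the nilpotent parts of the substitution
  have hχ : ∀ a b c g, χ (φ a b c g) = χ (φ a 0 c g) := by
    intro a b c g
    refine DFunLike.congr_fun (f := χ.comp (φ a b c)) (g := χ.comp (φ a 0 c))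
      (algHom_ext_of_generators hgen (fun i => ?_) (fun i => ?_)) g
    · simp [hy]
    · simp [hz, hb.char_n]
  have hkey := fun g => hG.mem_of_apply_eq_zero hr (χ := fun a c => χ.comp (φ a 0 c))
    (fun a c i => by simp [hy]) (fun a c i => by simp [hz, hb.char_h]) g
  have hφw : ∀ a b c i k, φ a b c ⁅z i, z k⁆ = (2 * (c i * b k - c k * b i)) • n := by
    intro a b c i k
    rw [Ring.lie_def, map_sub, map_mul, map_mul, hz, hz]
    exact minus_commutator_value hb _ _ _ _
  have hφu : ∀ a b c i, φ a b c (z i ^ (2 * r + 1) - z i) = ((c i ^ (2 * r) - 1) * b i) • n := by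
    intro a b c i
    rw [map_sub, map_pow, hz]
    exact minus_power_value hb hr _ _
  have hφθ : ∀ k a b c g, φ a b c (θ k g) =
      φ a (Function.update b k 0) (Function.update c k 0) g := by
    intro k a b c g
    refine DFunLike.congr_fun (f := (φ a b c).comp (θ k))
      (g := φ a (Function.update b k 0) (Function.update c k 0))
      (algHom_ext_of_generators hgen (fun i => ?_) (fun i => ?_)) g
    · simp [hy, hθ.apply_y]
    · by_cases hi : i = k
      · simp [hz, hθ.apply_z, hi]
      · simp [hz, hθ.apply_z, hi]
  have hxG : x ∈ Ideal.span G := (hkey x).1 fun a c => by simp [hx]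
  -- the terms of `x` involving `z k` collect in multiples of the `⁅z k, z i⁆` and of the power
  -- defect of `z k`
  have hstep : ∀ k, θ k x = x := by
    intro k
    have hmem : x - θ k x ∈ Ideal.span (Set.range fun i => ⁅z k, z i⁆) ⊔
        Ideal.span {z k ^ (2 * r + 1) - z k} := by
      set J := Ideal.span (Set.range fun i => ⁅z k, z i⁆) ⊔
        Ideal.span {z k ^ (2 * r + 1) - z k}
      have hw : ∀ i, ⁅z k, z i⁆ ∈ J := fun i =>
        Ideal.mem_sup_left (Ideal.subset_span ⟨i, rfl⟩)
      have hw' : ∀ i, ⁅z i, z k⁆ ∈ J := fun i => by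
        rw [hskew]; exact neg_mem (hw i)
      have hu : z k ^ (2 * r + 1) - z k ∈ J :=
        Ideal.mem_sup_right (Ideal.subset_span rfl)
      clear hx
      induction hxG using Submodule.span_induction with
      | zero => simp
      | add x x' _ _ hx hx' => rw [map_add, add_sub_add_comm]; exact add_mem hx hx'
      | smul g x hx' hx =>
        rw [smul_eq_mul, map_mul, show g * x - θ k g * θ k x =
          (g - θ k g) * x + θ k g * (x - θ k x) by noncomm_ring]
        refine add_mem (hG.sub_apply_mul_mem hθ k hx' ?_ g) (Ideal.mul_mem_left _ _ hx)
        have hzx : ∀ x ∈ Ideal.span G, z k * x ∈ J := by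
          intro x hx
          induction hx using Submodule.span_induction with
          | zero => simp
          | add x x' _ _ hx hx' => rw [mul_add]; exact add_mem hx hx'
          | smul g x hx' hx =>
            rw [smul_eq_mul, hG.mul_left_comm_of_mem _ _ hx']
            exact Ideal.mul_mem_left _ _ hx
          | mem m hm =>
            rcases hm with ⟨⟨i, j⟩, rfl⟩ | ⟨i, rfl⟩
            · change z k * ⁅z i, z j⁆ ∈ _
              rw [hs.zw]
              exact sub_mem (Ideal.mul_mem_left _ _ (hw j)) (Ideal.mul_mem_left _ _ (hw i))
            · change z k * (z i ^ (2 * r + 1) - z i) ∈ _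
              rw [hzu, ← mul_assoc]
              exact Ideal.mul_mem_left _ _ (hw i)
        exact hzx x hx'
      | mem m hm =>
        rcases hm with ⟨⟨i, j⟩, rfl⟩ | ⟨i, rfl⟩
        · change ⁅z i, z j⁆ - θ k ⁅z i, z j⁆ ∈ _
          rw [Ring.lie_def, map_sub, map_mul, map_mul, hθ.apply_z, hθ.apply_z]
          split_ifs with hi hj hj
          · simp [hi, hj]
          · simpa [hi, Ring.lie_def] using hw j
          · simpa [hj, Ring.lie_def] using hw' i
          · simp
        · change z i ^ (2 * r + 1) - z i - θ k (z i ^ (2 * r + 1) - z i) ∈ _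
          rw [map_sub, map_pow, hθ.apply_z]
          split_ifs with hi
          · simpa [hi] using hu
          · simp
    obtain ⟨x1, hx1, x2, hx2, hx12⟩ := Submodule.mem_sup.1 hmem
    obtain ⟨g0, rfl⟩ := Ideal.mem_span_singleton'.1 hx2
    obtain ⟨g, hg⟩ := exists_finsupp_of_mem_span hx1
    have hval : ∀ a b c : ℕ → F,
        ∑ i ∈ g.support, (χ (φ a 0 c (g i)) * (2 * (c k * b i - c i * b k))) • n +
          (χ (φ a 0 c g0) * ((c k ^ (2 * r) - 1) * b k)) • n = 0 := by
      intro a b c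
      have h0 : φ a b c (x - θ k x) = 0 := by rw [map_sub, hφθ, hx, hx, sub_zero]
      rw [← hx12, ← hg, Finsupp.sum, map_add, map_sum] at h0
      rw [← h0]
      congr 1
      · refine Finset.sum_congr rfl fun i _ => ?_
        rw [map_mul, hφw, mul_smul_comm, hb.mul_n, hχ a b c, smul_smul, mul_comm]
      · rw [map_mul, hφu, mul_smul_comm, hb.mul_n, hχ a b c, smul_smul, mul_comm]
    -- each multiple of `⁅z k, z i⁆` is a multiple of the power defect
    have hgk : ∀ i, g i * ⁅z k, z i⁆ ∈ Ideal.span {z k ^ (2 * r + 1) - z k} := by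
      intro i
      by_cases hik : i = k
      · simp [hik, Ring.lie_def]
      have h1 : ∀ a c, c k * χ (φ a 0 c (g i)) = 0 := by
        intro a c
        by_cases hi : i ∈ g.support
        · have h3 := hval a (Pi.single i 1) c
          rw [Finset.sum_eq_single i (fun j _ hj => by
              simp [Pi.single_eq_of_ne hj, Pi.single_eq_of_ne (Ne.symm hik)])
            (fun hi' => absurd hi hi'), Pi.single_eq_same, Pi.single_eq_of_ne (Ne.symm hik),
            mul_zero, mul_zero, mul_zero, zero_smul, add_zero,
            smul_eq_zero_iff_left hb.ne_zero] at h3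
          have h4 : (2 : F) * (c k * χ (φ a 0 c (g i))) = 0 := by linear_combination h3
          exact (mul_eq_zero.1 h4).resolve_left h2
        · simp [Finsupp.notMem_support_iff.1 hi]
      have h3 := hG.mul_eq_zero_of_mem ((hkey (g i)).2 k h1) (hwG k i)
      rw [mul_assoc, hG.mul_left_comm_of_mem _ _ (hwG k i)] at h3
      have h4 : g i * ⁅z k, z i⁆ = g i * 2 * z i * (z k ^ (2 * r + 1) - z k) := by
        have h5 := hs.zu k i
        rw [hskew i k, sub_mul, one_mul, mul_neg, sub_neg_eq_add, neg_add_eq_sub] at h5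
        rw [mul_assoc, mul_assoc, h5, mul_sub, h3, sub_zero]
      rw [h4]
      exact Ideal.mul_mem_left _ _ (Ideal.subset_span rfl)
    have hmem' : x - θ k x ∈ Ideal.span {z k ^ (2 * r + 1) - z k} := by
      rw [← hx12, ← hg]
      exact add_mem (sum_mem fun i _ => hgk i) hx2
    obtain ⟨g', hg'⟩ := Ideal.mem_span_singleton'.1 hmem'
    rcases Nat.eq_zero_or_pos r with rfl | hr0
    · simp only [mul_zero, zero_add, pow_one, sub_self] at hg'
      exact (sub_eq_zero.1 hg'.symm).symm
    -- for `c k = 0` the value of the power defect is `-(b k) • n`, so `g'` has zero character there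
    have hθg : θ k g' ∈ Ideal.span G := by
      refine (hkey _).1 fun a c => ?_
      rw [AlgHom.comp_apply, hφθ, hχ]
      have h0 : φ a (Pi.single k 1) (Function.update c k 0) (x - θ k x) = 0 := by
        rw [map_sub, hφθ, hx, hx, sub_zero]
      rw [← hg', map_mul, hφu, mul_smul_comm, hb.mul_n, hχ, smul_smul,
        smul_eq_zero_iff_left hb.ne_zero, Function.update_self, Pi.single_eq_same,
        zero_pow (by omega)] at h0
      linear_combination -h0
    -- the terms of `g'` involving `z k` do not matter, as `z k` kills its power defect
    have h3 : (g' - θ k g') * (z k ^ (2 * r + 1) - z k) ∈ (⊥ : Ideal B) :=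
      hG.sub_apply_mul_mem hθ k (huG k) (by rw [hs.zu_self]; exact zero_mem _) g'
    rw [Ideal.mem_bot, sub_mul, hG.mul_eq_zero_of_mem hθg (huG k), sub_zero, hg'] at h3
    exact (sub_eq_zero.1 h3).symm
  rw [← hθ.all_apply_eq hgen hstep]
  clear hx hstep
  induction hxG using Submodule.span_induction with
  | zero => simp
  | add x x' _ _ hx hx' => rw [map_add, hx, hx', add_zero]
  | smul g x _ hx => rw [smul_eq_mul, map_mul, hx, mul_zero]
  | mem m hm =>
    rcases hm with ⟨⟨i, j⟩, rfl⟩ | ⟨i, rfl⟩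
    · simp [Ring.lie_def, hθ.all_z]
    · simp [hθ.all_z]

end StarPoly

/-! ### Free algebras with involution, `T(*)`-spaces and `T(*)`-ideals -/

namespace StarPoly

universe u

section FreeStar

variable {F : Type u} [Field F]

theorem IsInvolution.map_one {A : Type*} [Ring A] {σ : A → A} (hσ : IsInvolution σ) : σ 1 = 1 := by
  calc σ 1 = σ 1 * σ (σ 1) := by rw [hσ.involutive, mul_one]
    _ = σ (σ 1 * 1) := (hσ.map_mul _ _).symm
    _ = 1 := by rw [mul_one, hσ.involutive]

theorem IsInvolution.map_zero {A : Type*} [Ring A] {σ : A → A} (hσ : IsInvolution σ) :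
    σ 0 = 0 := by
  simpa using hσ.map_add 0 0

theorem IsInvolution.map_sub {A : Type*} [Ring A] {σ : A → A} (hσ : IsInvolution σ) (a b : A) :
    σ (a - b) = σ a - σ b := by
  have h := hσ.map_add (a - b) b
  rw [sub_add_cancel] at h
  rw [h, add_sub_cancel_right]

theorem freeInvol_algebraMap (c : F) :
    freeInvol F (algebraMap F (FreeStar F) c) = algebraMap F (FreeStar F) c := by
  rw [Algebra.algebraMap_eq_smul_one, freeInvol_smul, (freeInvol_isInvolution F).map_one]

variable {A : Type*} [Ring A] [Algebra F A] {σ : A → A}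

theorem evalStar_inl (a : ℕ → A) (i : ℕ) :
    evalStar (F := F) σ a (FreeAlgebra.ι F (Sum.inl i)) = a i := by
  simp [evalStar]

theorem evalStar_inr (a : ℕ → A) (i : ℕ) :
    evalStar (F := F) σ a (FreeAlgebra.ι F (Sum.inr i)) = σ (a i) := by
  simp [evalStar]

theorem evalStar_freeInvol (hσ : IsInvolution σ)
    (hσF : ∀ c : F, σ (algebraMap F A c) = algebraMap F A c) (a : ℕ → A) (f : FreeStar F) :
    evalStar σ a (freeInvol F f) = σ (evalStar σ a f) := by
  have hfree := freeInvol_isInvolution F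
  induction f using FreeAlgebra.induction with
  | grade0 c => rw [freeInvol_algebraMap, AlgHom.commutes, hσF]
  | grade1 i =>
    rcases i with i | i
    · rw [freeInvol_x, evalStar_inl, evalStar_inr]
    · rw [freeInvol_xStar, evalStar_inl, evalStar_inr, hσ.involutive]
  | mul f g hf hg => rw [hfree.map_mul, map_mul, hf, hg, map_mul, hσ.map_mul]
  | add f g hf hg => rw [hfree.map_add, map_add, hf, hg, map_add, hσ.map_add]

/-- The `*`-endomorphism with prescribed values at the variables `x_i`. -/
noncomputable abbrev starEnd (p : ℕ → FreeStar F) : FreeStar F →ₐ[F] FreeStar F :=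
  evalStar (freeInvol F) p

theorem isStarEnd_starEnd (p : ℕ → FreeStar F) : IsStarEnd (starEnd p) := fun f =>
  evalStar_freeInvol (freeInvol_isInvolution F) freeInvol_algebraMap p f

theorem evalStar_apply_of_isStarEnd (hσ : IsInvolution σ)
    (hσF : ∀ c : F, σ (algebraMap F A c) = algebraMap F A c) (a : ℕ → A)
    {φ : FreeStar F →ₐ[F] FreeStar F} (hφ : IsStarEnd φ) (f : FreeStar F) :
    evalStar σ a (φ f) =
      evalStar σ (fun i => evalStar σ a (φ (FreeAlgebra.ι F (Sum.inl i)))) f := by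
  refine DFunLike.congr_fun (f := (evalStar σ a).comp φ) (FreeAlgebra.hom_ext ?_) f
  funext i
  rcases i with i | i
  · simp [evalStar]
  · rw [Function.comp_apply, Function.comp_apply, AlgHom.comp_apply, evalStar_inr, ← freeInvol_x,
      hφ, evalStar_freeInvol hσ hσF]

theorem isTStarSpace_starIdentities (hσ : IsInvolution σ)
    (hσF : ∀ c : F, σ (algebraMap F A c) = algebraMap F A c) :
    IsTStarSpace (starIdentities F σ) := by
  intro φ hφ f hf a
  rw [evalStar_apply_of_isStarEnd hσ hσF a hφ]
  exact hf _

theorem isTStarSpace_starCentral (hσ : IsInvolution σ)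
    (hσF : ∀ c : F, σ (algebraMap F A c) = algebraMap F A c) :
    IsTStarSpace (starCentral F σ) := by
  intro φ hφ f hf a
  rw [evalStar_apply_of_isStarEnd hσ hσF a hφ]
  exact hf _

theorem subset_tStarSpan (W : Set (FreeStar F)) : W ⊆ tStarSpan W := by
  intro f hf
  rw [tStarSpan, SetLike.mem_coe, Submodule.mem_sInf]
  exact fun V hV => hV.2 hf

theorem isTStarSpace_tStarSpan (W : Set (FreeStar F)) : IsTStarSpace (tStarSpan W) := by
  intro φ hφ f hf
  rw [tStarSpan, Submodule.mem_sInf] at hf ⊢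
  exact fun V hV => hV.1 φ hφ f (hf V hV)

theorem tStarSpan_le {W : Set (FreeStar F)} {V : Submodule F (FreeStar F)} (hV : IsTStarSpace V)
    (hW : W ⊆ V) : tStarSpan W ≤ V :=
  sInf_le ⟨hV, hW⟩

/-- The symmetric element `x_i + x_i*`. -/
noncomputable def symVar (F : Type u) [Field F] (i : ℕ) : FreeStar F :=
  FreeAlgebra.ι F (Sum.inl i) + FreeAlgebra.ι F (Sum.inr i)

/-- The skew element `x_i - x_i*`. -/
noncomputable def skewVar (F : Type u) [Field F] (i : ℕ) : FreeStar F :=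
  FreeAlgebra.ι F (Sum.inl i) - FreeAlgebra.ι F (Sum.inr i)

theorem evalStar_symVar (a : ℕ → A) (i : ℕ) : evalStar σ a (symVar F i) = a i + σ (a i) := by
  rw [symVar, map_add, evalStar_inl, evalStar_inr]

theorem evalStar_skewVar (a : ℕ → A) (i : ℕ) : evalStar σ a (skewVar F i) = a i - σ (a i) := by
  rw [skewVar, map_sub, evalStar_inl, evalStar_inr]

/-- The largest two-sided ideal closed under `*`-endomorphisms inside the subspace `V`. -/
def largestTIdeal (V : Submodule F (FreeStar F)) : Ideal (FreeStar F) where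
  carrier := {f | ∀ φ : FreeStar F →ₐ[F] FreeStar F, IsStarEnd φ → ∀ a b, a * φ f * b ∈ V}
  add_mem' {f g} hf hg φ hφ a b := by
    rw [map_add, mul_add, add_mul]
    exact add_mem (hf φ hφ a b) (hg φ hφ a b)
  zero_mem' φ _ a b := by simp
  smul_mem' c f hf φ hφ a b := by
    rw [smul_eq_mul, map_mul, ← mul_assoc]
    exact hf φ hφ _ b

instance (V : Submodule F (FreeStar F)) : (largestTIdeal V).IsTwoSided where
  mul_mem_of_left c hf φ hφ a b := by
    rw [map_mul, ← mul_assoc, mul_assoc _ _ b]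
    exact hf φ hφ _ _

theorem apply_mem_largestTIdeal {V : Submodule F (FreeStar F)}
    {φ : FreeStar F →ₐ[F] FreeStar F} (hφ : IsStarEnd φ) {f : FreeStar F}
    (hf : f ∈ largestTIdeal V) : φ f ∈ largestTIdeal V := fun ψ hψ a b =>
  hf (ψ.comp φ) (fun g => by rw [AlgHom.comp_apply, hφ, hψ, AlgHom.comp_apply]) a b

theorem mem_of_mem_largestTIdeal {V : Submodule F (FreeStar F)} {f : FreeStar F}
    (hf : f ∈ largestTIdeal V) : f ∈ V := by
  simpa using hf (AlgHom.id F _) (fun g => rfl) 1 1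

end FreeStar

section Relations

variable {F : Type u} [Field F]

/-- A finite list of polynomials in four variables `y` and four variables `z`, over every ring. -/
abbrev RelationList : Type (u + 1) :=
  ∀ {R : Type u} [Ring R], (Fin 4 → R) → (Fin 4 → R) → List R

/-- The list of polynomials is compatible with ring homomorphisms. -/
def IsNatural (rel : RelationList.{u}) : Prop :=
  ∀ {R S : Type u} [Ring R] [Ring S] (f : R →+* S) (y z : Fin 4 → R),
    (rel y z).map f = rel (f ∘ y) (f ∘ z)

theorem plusRelations_isNatural (r : ℕ) : IsNatural.{u} (fun {_} _ y z => plusRelations r y z) := by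
  intro R S _ _ f y z
  simp [plusRelations]

theorem minusRelations_isNatural (r : ℕ) :
    IsNatural.{u} (fun {_} _ y z => minusRelations r y z) := by
  intro R S _ _ f y z
  simp [minusRelations, map_ofNat f 2]

/-- Generators, as a `T(*)`-space, of the `T(*)`-ideal generated by `rel` in the symmetric and the
skew elements: the relations multiplied by new variables from both sides. -/
noncomputable def relationGenerators (F : Type u) [Field F] (rel : RelationList.{u}) :
    Set (FreeStar F) :=
  {f | f ∈ (rel (fun i : Fin 4 => symVar F i) (fun i : Fin 4 => skewVar F i)).map
    fun g => FreeAlgebra.ι F (Sum.inl 4) * g * FreeAlgebra.ι F (Sum.inl 5)}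

theorem relationGenerators_finite (rel : RelationList.{u}) :
    (relationGenerators F rel).Finite :=
  List.finite_toSet _

theorem apply_symVar {φ : FreeStar F →ₐ[F] FreeStar F} (hφ : IsStarEnd φ) (i : ℕ) :
    φ (symVar F i) = φ (FreeAlgebra.ι F (Sum.inl i)) +
      freeInvol F (φ (FreeAlgebra.ι F (Sum.inl i))) := by
  rw [symVar, map_add, ← freeInvol_x, hφ]

theorem apply_skewVar {φ : FreeStar F →ₐ[F] FreeStar F} (hφ : IsStarEnd φ) (i : ℕ) :
    φ (skewVar F i) = φ (FreeAlgebra.ι F (Sum.inl i)) -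
      freeInvol F (φ (FreeAlgebra.ι F (Sum.inl i))) := by
  rw [skewVar, map_sub, ← freeInvol_x, hφ]

theorem mem_largestTIdeal_of_relation {rel : RelationList.{u}} (hrel : IsNatural rel)
    (s : Fin 4 → ℕ) {f : FreeStar F}
    (hf : f ∈ rel (fun i => symVar F (s i)) (fun i => skewVar F (s i))) :
    f ∈ largestTIdeal (tStarSpan (relationGenerators F rel)) := by
  intro φ hφ a b
  -- the substitution sending a generator to `a * φ f * b`
  set p : ℕ → FreeStar F := fun i => if hi : i < 4 then φ (FreeAlgebra.ι F (Sum.inl (s ⟨i, hi⟩)))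
    else if i = 4 then a else b with hp
  have hψ := isStarEnd_starEnd p
  have h4 : starEnd p (FreeAlgebra.ι F (Sum.inl 4)) = a := by simp [evalStar_inl, hp]
  have h5 : starEnd p (FreeAlgebra.ι F (Sum.inl 5)) = b := by simp [evalStar_inl, hp]
  have hx : ∀ i : Fin 4, starEnd p (FreeAlgebra.ι F (Sum.inl (i : ℕ))) =
      φ (FreeAlgebra.ι F (Sum.inl (s i))) := by
    intro i
    rw [evalStar_inl, hp]
    simp
  have h1 : φ f ∈ (rel (fun i => symVar F (s i)) (fun i => skewVar F (s i))).map
      (φ : FreeStar F →+* FreeStar F) := List.mem_map_of_mem hf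
  have h2 : (rel (fun i => symVar F (s i)) (fun i => skewVar F (s i))).map
      (φ : FreeStar F →+* FreeStar F) =
      (rel (fun i : Fin 4 => symVar F i) (fun i : Fin 4 => skewVar F i)).map
        (starEnd p : FreeStar F →+* FreeStar F) := by
    rw [hrel, hrel]
    congr 1
    · funext i
      change φ _ = starEnd p _
      rw [apply_symVar hφ, apply_symVar hψ, hx]
    · funext i
      change φ _ = starEnd p _
      rw [apply_skewVar hφ, apply_skewVar hψ, hx]
  rw [h2] at h1
  obtain ⟨g, hg, hgf⟩ := List.mem_map.1 h1
  have h3 := isTStarSpace_tStarSpan (relationGenerators F rel) (starEnd p) hψ _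
    (subset_tStarSpan _ (List.mem_map_of_mem hg))
  rw [map_mul, map_mul, h4, h5] at h3
  rw [← hgf]
  exact h3

end Relations

/-- `σ` is an `F`-linear involution of the algebra `A` with basis `1`, `h`, `n`, where `h` and `n`
multiply like `diag(1, -1)` and `e₁₂`; it negates `h` and multiplies `n` by `ε`. -/
structure IsTriangularInvolution {F A : Type*} [Field F] [Ring A] [Algebra F A] (σ : A → A)
    (h n : A) (χ : A →ₐ[F] F) (ε : F) : Prop where
  basis : IsTriangularBasis h n χ
  involution : IsInvolution σ
  linear : ∀ (c : F) (a : A), σ (c • a) = c • σ a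
  span : ∀ x : A, ∃ a b c : F, x = a • (1 : A) + b • n + c • h
  map_h : σ h = -h
  map_n : σ n = ε • n

namespace IsTriangularInvolution

section

variable {F A : Type*} [Field F] [Ring A] [Algebra F A] {σ : A → A} {h n : A} {χ : A →ₐ[F] F}
  {ε : F}

theorem map_algebraMap (hσ : IsTriangularInvolution σ h n χ ε) (c : F) :
    σ (algebraMap F A c) = algebraMap F A c := by
  rw [Algebra.algebraMap_eq_smul_one, hσ.linear, hσ.involution.map_one]

theorem map_combination (hσ : IsTriangularInvolution σ h n χ ε) (a b c : F) :
    σ (a • (1 : A) + b • n + c • h) = a • (1 : A) + (ε * b) • n - c • h := by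
  rw [hσ.involution.map_add, hσ.involution.map_add, hσ.linear, hσ.linear, hσ.linear,
    hσ.map_h, hσ.map_n, hσ.involution.map_one, smul_smul, smul_neg, mul_comm b, sub_eq_add_neg]

end

variable {F A : Type u} [Field F] [Ring A] [Algebra F A] {σ : A → A} {h n : A} {χ : A →ₐ[F] F}
  {ε : F}

theorem tStarSpan_relationGenerators_le (hσ : IsTriangularInvolution σ h n χ ε)
    {rel : RelationList.{u}} (hrel : IsNatural rel)
    (hA : ∀ a : ℕ → A, ∀ f ∈ rel (fun i : Fin 4 => a i + σ (a i)) (fun i : Fin 4 => a i - σ (a i)),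
      f = 0) :
    tStarSpan (relationGenerators F rel) ≤ starIdentities F σ := by
  refine tStarSpan_le (isTStarSpace_starIdentities hσ.involution hσ.map_algebraMap) ?_
  intro f hf a
  obtain ⟨g, hg, rfl⟩ := List.mem_map.1 hf
  have h1 : evalStar σ a g ∈ (rel (fun i : Fin 4 => symVar F i) (fun i : Fin 4 => skewVar F i)).map
      (evalStar σ a).toRingHom := List.mem_map_of_mem (f := (evalStar σ a).toRingHom) hg
  rw [hrel] at h1
  have h2 : evalStar σ a g = 0 := by
    refine hA a _ ?_
    convert h1 using 2
    · funext i; exact (evalStar_symVar a i).symm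
    · funext i; exact (evalStar_skewVar a i).symm
  rw [map_mul, map_mul, h2, mul_zero, zero_mul]

end IsTriangularInvolution

end StarPoly

/-! ### A finite basis of the identities -/

namespace StarPoly

universe u

/-- Substitutions into the triangular matrices detect zero in an algebra generated by `y` and `z`
with endomorphisms deleting the `z k`, as soon as the relations `rel` hold there. The matrices
`Y a b c i` and `Z a b c i` are the admissible values of `y i` and `z i`. -/
def DetectsZero {F A : Type u} [Field F] [Ring A] [Algebra F A] (rel : RelationList.{u})
    (Y Z : (ℕ → F) → (ℕ → F) → (ℕ → F) → ℕ → A) : Prop :=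
  ∀ {B : Type u} [Ring B] [Algebra F B] (y z : ℕ → B),
    (∀ s : Fin 4 → ℕ, ∀ f ∈ rel (y ∘ s) (z ∘ s), f = 0) →
    Algebra.adjoin F (Set.range y ∪ Set.range z) = ⊤ →
    ∀ (θ : ℕ → B →ₐ[F] B) (Θ : B →ₐ[F] B), IsVanishingSystem y z θ Θ →
    ∀ φ : (ℕ → F) → (ℕ → F) → (ℕ → F) → B →ₐ[F] A, (∀ a b c i, φ a b c (y i) = Y a b c i) →
    (∀ a b c i, φ a b c (z i) = Z a b c i) → ∀ x, (∀ a b c, φ a b c x = 0) → x = 0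

section

variable {F : Type u} [Field F]

theorem half_add_half (hF : ringChar F ≠ 2) {M : Type*} [AddCommGroup M] [Module F M] (x : M) :
    (1 / 2 : F) • x + (1 / 2 : F) • x = x := by
  have h2 : (2 : F) ≠ 0 := Ring.two_ne_zero hF
  rw [← add_smul, ← add_div, one_add_one_eq_two, div_self h2, one_smul]

/-- The variable `x_i` with its skew part deleted. -/
noncomputable def symHalf (F : Type u) [Field F] (i : ℕ) : FreeStar F := (1 / 2 : F) • symVar F i

theorem freeInvol_symHalf (i : ℕ) : freeInvol F (symHalf F i) = symHalf F i := by
  rw [symHalf, freeInvol_smul, symVar, (freeInvol_isInvolution F).map_add, freeInvol_x,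
    freeInvol_xStar, add_comm]

theorem symHalf_add_self (hF : ringChar F ≠ 2) (i : ℕ) : symHalf F i + symHalf F i = symVar F i :=
  half_add_half hF _

theorem adjoin_symVar_skewVar (hF : ringChar F ≠ 2) (I : Ideal (FreeStar F)) [I.IsTwoSided] :
    Algebra.adjoin F (Set.range (fun i => Ideal.Quotient.mk I (symVar F i)) ∪
      Set.range (fun i => Ideal.Quotient.mk I (skewVar F i))) = ⊤ := by
  set S := Algebra.adjoin F (Set.range (fun i => Ideal.Quotient.mk I (symVar F i)) ∪
      Set.range (fun i => Ideal.Quotient.mk I (skewVar F i)))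
  have hy : ∀ i, Ideal.Quotient.mk I (symVar F i) ∈ S := fun i =>
    Algebra.subset_adjoin (Or.inl ⟨i, rfl⟩)
  have hz : ∀ i, Ideal.Quotient.mk I (skewVar F i) ∈ S := fun i =>
    Algebra.subset_adjoin (Or.inr ⟨i, rfl⟩)
  rw [eq_top_iff]
  rintro b -
  obtain ⟨f, rfl⟩ := Ideal.Quotient.mk_surjective b
  induction f using FreeAlgebra.induction with
  | grade0 c => exact S.algebraMap_mem c
  | grade1 i =>
    have h1 : ∀ x : FreeStar F, Ideal.Quotient.mk I (x + x) ∈ S → Ideal.Quotient.mk I x ∈ S := by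
      intro x hx
      have := S.smul_mem hx (1 / 2 : F)
      rw [map_add, smul_add, half_add_half hF] at this
      exact this
    rcases i with i | i
    · refine h1 _ ?_
      have := S.add_mem (hy i) (hz i)
      rw [← map_add] at this
      convert this using 2
      rw [symVar, skewVar]; abel
    · refine h1 _ ?_
      have := S.sub_mem (hy i) (hz i)
      rw [← map_sub] at this
      convert this using 2
      rw [symVar, skewVar]; abel
  | mul f g hf hg => rw [map_mul]; exact mul_mem hf hg
  | add f g hf hg => rw [map_add]; exact add_mem hf hg

theorem starEnd_of_eq_symHalf (hF : ringChar F ≠ 2) {p : ℕ → FreeStar F} {i : ℕ}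
    (hp : p i = symHalf F i) :
    starEnd p (symVar F i) = symVar F i ∧ starEnd p (skewVar F i) = 0 := by
  rw [apply_symVar (isStarEnd_starEnd p), apply_skewVar (isStarEnd_starEnd p), evalStar_inl, hp,
    freeInvol_symHalf, symHalf_add_self hF, sub_self]
  exact ⟨rfl, rfl⟩

theorem starEnd_of_eq_ι {p : ℕ → FreeStar F} {i : ℕ}
    (hp : p i = FreeAlgebra.ι F (Sum.inl i)) :
    starEnd p (symVar F i) = symVar F i ∧ starEnd p (skewVar F i) = skewVar F i := by
  rw [apply_symVar (isStarEnd_starEnd p), apply_skewVar (isStarEnd_starEnd p), evalStar_inl, hp,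
    freeInvol_x]
  exact ⟨rfl, rfl⟩

end

variable {F A : Type u} [Field F] [Ring A] [Algebra F A] {σ : A → A} {h n : A} {χ : A →ₐ[F] F}
  {ε : F}

/-- If `rel` consists of identities and its consequences detect zero through the values of
symmetric and skew elements, then every identity follows from `rel`. -/
theorem IsTriangularInvolution.starIdentities_le (hσ : IsTriangularInvolution σ h n χ ε)
    (hF : ringChar F ≠ 2) {rel : RelationList.{u}} (hrel : IsNatural rel)
    (hA : ∀ a : ℕ → A, ∀ f ∈ rel (fun i : Fin 4 => a i + σ (a i)) (fun i : Fin 4 => a i - σ (a i)),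
      f = 0)
    {Y Z : (ℕ → F) → (ℕ → F) → (ℕ → F) → ℕ → A} (hdet : DetectsZero rel Y Z)
    (hY : ∀ a b c i, σ (Y a b c i) = Y a b c i) (hZ : ∀ a b c i, σ (Z a b c i) = -Z a b c i) :
    starIdentities F σ ≤ tStarSpan (relationGenerators F rel) := by
  intro f hf
  set I := largestTIdeal (tStarSpan (relationGenerators F rel))
  have hIA : ∀ (a : ℕ → A), ∀ g ∈ I, evalStar σ a g = 0 := fun a g hg =>
    hσ.tStarSpan_relationGenerators_le hrel hA (mem_of_mem_largestTIdeal hg) a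
  -- `*`-endomorphisms and substitutions into `A` descend to the quotient by `I`
  let E : (p : ℕ → FreeStar F) → (FreeStar F ⧸ I) →ₐ[F] (FreeStar F ⧸ I) := fun p =>
    Ideal.Quotient.liftₐ I ((Ideal.Quotient.mkₐ F I).comp (starEnd p)) fun g hg =>
      Ideal.Quotient.eq_zero_iff_mem.2 (apply_mem_largestTIdeal (isStarEnd_starEnd p) hg)
  have hE : ∀ p g, E p (Ideal.Quotient.mk I g) = Ideal.Quotient.mk I (starEnd p g) :=
    fun p g => rfl
  let pk : ℕ → ℕ → FreeStar F := fun k i =>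
    if i = k then symHalf F i else FreeAlgebra.ι F (Sum.inl i)
  let φ : (ℕ → F) → (ℕ → F) → (ℕ → F) → (FreeStar F ⧸ I) →ₐ[F] A := fun a b c =>
    Ideal.Quotient.liftₐ I (evalStar σ fun i => (1 / 2 : F) • (Y a b c i + Z a b c i))
      fun g hg => hIA _ g hg
  have hφ : ∀ a b c g, φ a b c (Ideal.Quotient.mk I g) =
      evalStar σ (fun i => (1 / 2 : F) • (Y a b c i + Z a b c i)) g := fun a b c g => rfl
  have hmk : Ideal.Quotient.mk I f = 0 := by
    refine hdet (fun i => Ideal.Quotient.mk I (symVar F i))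
      (fun i => Ideal.Quotient.mk I (skewVar F i)) ?_ (adjoin_symVar_skewVar hF I)
      (fun k => E (pk k)) (E (symHalf F)) ⟨?_, ?_, ?_, ?_⟩ φ ?_ ?_ _ ?_
    · intro s g hg
      have h1 := hrel (Ideal.Quotient.mk I) (fun i => symVar F (s i)) (fun i => skewVar F (s i))
      have h2 : g ∈ (rel (fun i => symVar F (s i)) (fun i => skewVar F (s i))).map
        (Ideal.Quotient.mk I) := by rw [h1]; exact hg
      obtain ⟨g', hg', rfl⟩ := List.mem_map.1 h2
      exact Ideal.Quotient.eq_zero_iff_mem.2 (mem_largestTIdeal_of_relation hrel s hg')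
    · intro k i
      rw [hE]
      by_cases hik : i = k
      · rw [(starEnd_of_eq_symHalf hF (if_pos hik)).1]
      · rw [(starEnd_of_eq_ι (if_neg hik)).1]
    · intro k i
      rw [hE]
      by_cases hik : i = k
      · rw [(starEnd_of_eq_symHalf hF (if_pos hik)).2, if_pos hik, map_zero]
      · rw [(starEnd_of_eq_ι (if_neg hik)).2, if_neg hik]
    · intro i
      rw [hE, (starEnd_of_eq_symHalf hF rfl).1]
    · intro i
      rw [hE, (starEnd_of_eq_symHalf hF rfl).2, map_zero]
    · intro a b c i
      rw [hφ, evalStar_symVar, hσ.linear, hσ.involution.map_add, hY, hZ, ← smul_add,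
        add_add_add_comm, add_neg_cancel, add_zero, smul_add, half_add_half hF]
    · intro a b c i
      rw [hφ, evalStar_skewVar, hσ.linear, hσ.involution.map_add, hY, hZ, ← smul_sub,
        add_sub_add_left_eq_sub, sub_neg_eq_add, smul_add, half_add_half hF]
    · intro a b c
      rw [hφ]
      exact hf _
  exact mem_of_mem_largestTIdeal (Ideal.Quotient.eq_zero_iff_mem.1 hmk)

theorem IsTriangularInvolution.starIdentities_eq_of_plus (hσ : IsTriangularInvolution σ h n χ 1)
    (hF : ringChar F ≠ 2) {r : ℕ} (hr : IsReducedExponent F r) :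
    starIdentities F σ =
      tStarSpan (relationGenerators F (fun {_} _ y z => plusRelations r y z)) := by
  have hA : ∀ a : ℕ → A, ∀ f ∈ plusRelations r (fun i : Fin 4 => a i + σ (a i))
      (fun i : Fin 4 => a i - σ (a i)), f = 0 := by
    intro a
    refine plusRelations_eq_zero hσ.basis hr (fun i => ?_) (fun i => ?_)
    · obtain ⟨c, d, e, hx⟩ := hσ.span (a i)
      refine ⟨2 * c, 2 * d, ?_⟩
      rw [hx, hσ.map_combination]
      module
    · obtain ⟨c, d, e, hx⟩ := hσ.span (a i)
      refine ⟨2 * e, ?_⟩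
      rw [hx, hσ.map_combination]
      module
  refine le_antisymm (hσ.starIdentities_le hF (plusRelations_isNatural r) hA
    (Y := fun a b _ i => a i • (1 : A) + b i • n) (Z := fun _ _ c i => c i • h) ?_ ?_ ?_)
    (hσ.tStarSpan_relationGenerators_le (plusRelations_isNatural r) hA)
  · intro B _ _ y z hrel hgen θ Θ hθ φ hy hz x hx
    exact (PlusSystem.of_relations hrel).eq_zero_of_apply_eq_zero hgen hF hr hσ.basis hθ hy hz hx
  · intro a b c i
    rw [hσ.involution.map_add, hσ.linear, hσ.linear, hσ.map_n, hσ.involution.map_one, one_smul]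
  · intro a b c i
    rw [hσ.linear, hσ.map_h, smul_neg]

theorem IsTriangularInvolution.starIdentities_eq_of_minus
    (hσ : IsTriangularInvolution σ h n χ (-1)) (hF : ringChar F ≠ 2) {r : ℕ}
    (hr : IsReducedExponent F r) :
    starIdentities F σ =
      tStarSpan (relationGenerators F (fun {_} _ y z => minusRelations r y z)) := by
  have hA : ∀ a : ℕ → A, ∀ f ∈ minusRelations r (fun i : Fin 4 => a i + σ (a i))
      (fun i : Fin 4 => a i - σ (a i)), f = 0 := by
    intro a
    refine minusRelations_eq_zero hσ.basis hr (fun i => ?_) (fun i => ?_)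
    · obtain ⟨c, d, e, hx⟩ := hσ.span (a i)
      refine ⟨2 * c, ?_⟩
      rw [hx, hσ.map_combination]
      module
    · obtain ⟨c, d, e, hx⟩ := hσ.span (a i)
      refine ⟨2 * e, 2 * d, ?_⟩
      rw [hx, hσ.map_combination]
      module
  refine le_antisymm (hσ.starIdentities_le hF (minusRelations_isNatural r) hA
    (Y := fun a _ _ i => a i • (1 : A)) (Z := fun _ b c i => c i • h + b i • n) ?_ ?_ ?_)
    (hσ.tStarSpan_relationGenerators_le (minusRelations_isNatural r) hA)
  · intro B _ _ y z hrel hgen θ Θ hθ φ hy hz x hx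
    exact (MinusSystem.of_relations hrel).eq_zero_of_apply_eq_zero hgen hF hr hσ.basis hθ hy hz hx
  · intro a b c i
    rw [hσ.linear, hσ.involution.map_one]
  · intro a b c i
    rw [hσ.involution.map_add, hσ.linear, hσ.linear, hσ.map_n, hσ.map_h]
    module

end StarPoly

/-! ### Central polynomials -/

namespace StarPoly

universe u

variable {F A : Type u} [Field F] [Ring A] [Algebra F A] {σ : A → A} {h n : A} {χ : A →ₐ[F] F}
  {ε : F}

namespace IsTriangularInvolution

theorem char_combination (hσ : IsTriangularInvolution σ h n χ ε) (a b c : F) :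
    χ (a • (1 : A) + b • n + c • h) = a + c := by
  simp [hσ.basis.char_h, hσ.basis.char_n]

theorem eq_char_smul_one {x : A} {c : F}
    (hx : x = c • (1 : A)) : x = χ x • (1 : A) := by
  rw [hx, map_smul, map_one, smul_eq_mul, mul_one]

/-- The center consists of the scalars. -/
theorem mem_center_iff (hσ : IsTriangularInvolution σ h n χ ε) (hF : ringChar F ≠ 2) (x : A) :
    x ∈ Subalgebra.center F A ↔ x = χ x • (1 : A) := by
  have h2 : (2 : F) ≠ 0 := Ring.two_ne_zero hF
  rw [Subalgebra.mem_center_iff]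
  constructor
  · intro hx
    obtain ⟨a, b, c, rfl⟩ := hσ.span x
    have hb : (2 * b) • n = 0 := by
      have := hx h
      simp only [mul_add, add_mul, mul_smul_comm, smul_mul_assoc, hσ.basis.hh, hσ.basis.hn,
        hσ.basis.nh, mul_one, one_mul] at this
      have h3 : b • n = -(b • n) := by simpa using this
      rw [mul_smul, two_smul]
      exact add_eq_zero_iff_eq_neg.2 h3
    have hc : (2 * c) • n = 0 := by
      have := hx n
      simp only [mul_add, add_mul, mul_smul_comm, smul_mul_assoc, hσ.basis.nn, hσ.basis.hn,
        hσ.basis.nh, mul_one, one_mul] at this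
      have h3 : c • n = -(c • n) := by simpa using this.symm
      rw [mul_smul, two_smul]
      exact add_eq_zero_iff_eq_neg.2 h3
    rw [smul_eq_zero_iff_left hσ.basis.ne_zero, mul_eq_zero, or_iff_right h2] at hb hc
    rw [hσ.char_combination, hb, hc]
    simp
  · intro hx b
    rw [hx, mul_smul_comm, smul_mul_assoc, mul_one, one_mul]

theorem mem_starCentral_iff (hσ : IsTriangularInvolution σ h n χ ε) (hF : ringChar F ≠ 2)
    (f : FreeStar F) :
    f ∈ starCentral F σ ↔ ∀ a, evalStar σ a f = χ (evalStar σ a f) • (1 : A) :=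
  forall_congr' fun _ => hσ.mem_center_iff hF _

theorem evalStar_freeInvol (hσ : IsTriangularInvolution σ h n χ ε) (a : ℕ → A) (f : FreeStar F) :
    evalStar σ a (freeInvol F f) = σ (evalStar σ a f) :=
  StarPoly.evalStar_freeInvol hσ.involution hσ.map_algebraMap a f

theorem isTStarSpace_starCentral (hσ : IsTriangularInvolution σ h n χ ε) :
    IsTStarSpace (starCentral F σ) :=
  StarPoly.isTStarSpace_starCentral hσ.involution hσ.map_algebraMap

theorem starIdentities_le_starCentral : starIdentities F σ ≤ starCentral F σ := by
  intro f hf a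
  rw [hf a]
  exact zero_mem _

/-- A central polynomial which is zero under some substitution and not under another is not the sum
of an identity and a scalar. -/
theorem starCentral_ne {f : FreeStar F}
    (hf : f ∈ starCentral F σ) {a b : ℕ → A} (ha : evalStar σ a f = 0) (hb : evalStar σ b f ≠ 0) :
    starCentral F σ ≠ starIdentities F σ ⊔ scalars F := by
  intro heq
  rw [heq] at hf
  obtain ⟨g, hg, s, hs, rfl⟩ := Submodule.mem_sup.1 hf
  obtain ⟨c, rfl⟩ := Submodule.mem_span_singleton.1 hs
  rw [map_add, hg a, zero_add, map_smul, map_one] at ha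
  rw [map_add, hg b, zero_add, map_smul, map_one] at hb
  exact hb ha

theorem sub_mem_starIdentities {f g : FreeStar F}
    (hfg : ∀ a, evalStar σ a f = evalStar σ a g) : f - g ∈ starIdentities F σ := fun a => by
  rw [map_sub, hfg, sub_self]

theorem isFG_of_minus (hσ : IsTriangularInvolution σ h n χ (-1)) (hF : ringChar F ≠ 2) :
    IsFGTStarSpace (starCentral F σ) ∧
      starCentral F σ ≠ starIdentities F σ ⊔ scalars F := by
  obtain ⟨r, hr⟩ := exists_isReducedExponent hF
  have h2 : (2 : F) ≠ 0 := Ring.two_ne_zero hF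
  have hId := hσ.starIdentities_eq_of_minus hF hr
  set W := relationGenerators F (fun {_} _ y z => minusRelations r y z)
  have hsym : symVar F 0 ∈ starCentral F σ := by
    rw [hσ.mem_starCentral_iff hF]
    intro a
    obtain ⟨c, d, e, hx⟩ := hσ.span (a 0)
    refine eq_char_smul_one (c := 2 * c) ?_
    rw [evalStar_symVar, hx, hσ.map_combination]
    module
  refine ⟨⟨hσ.isTStarSpace_starCentral, W ∪ {symVar F 0},
    (relationGenerators_finite _).union (Set.finite_singleton _), le_antisymm ?_ ?_⟩, ?_⟩
  · intro f hf
    have hT := isTStarSpace_tStarSpan (W ∪ {symVar F 0})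
    have hIdV : starIdentities F σ ≤ tStarSpan (W ∪ {symVar F 0}) := by
      rw [hId]
      exact tStarSpan_le hT fun g hg => subset_tStarSpan _ (Or.inl hg)
    have h1 : f + freeInvol F f ∈ tStarSpan (W ∪ {symVar F 0}) := by
      have := hT (starEnd fun _ => f) (isStarEnd_starEnd _) _ (subset_tStarSpan _ (Or.inr rfl))
      rwa [evalStar_symVar] at this
    have h3 : f - freeInvol F f ∈ starIdentities F σ := by
      refine sub_mem_starIdentities fun a => ?_
      rw [hσ.evalStar_freeInvol, (hσ.mem_starCentral_iff hF f).1 hf a, hσ.linear,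
        hσ.involution.map_one]
    have h4 := Submodule.smul_mem _ (1 / 2 : F) (add_mem h1 (hIdV h3))
    rwa [add_add_sub_cancel, smul_add, half_add_half hF] at h4
  · refine tStarSpan_le hσ.isTStarSpace_starCentral ?_
    rintro f (hf | rfl)
    · exact starIdentities_le_starCentral (hId ▸ subset_tStarSpan W hf)
    · exact hsym
  · refine starCentral_ne hsym (a := fun _ => 0) (b := fun _ => 1) ?_ ?_
    · rw [evalStar_symVar, zero_add]
      simpa using hσ.linear 0 0
    · rw [evalStar_symVar, hσ.involution.map_one, one_add_one_eq_two]
      intro h0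
      have := congrArg χ h0
      rw [map_ofNat, map_zero] at this
      exact h2 this

/-! ### Central polynomials for an involution fixing `e₁₂` -/

section Plus

variable {r : ℕ}

/-- The span of the products of two skew polynomials. -/
noncomputable def skewProducts (F : Type u) [Field F] : Submodule F (FreeStar F) :=
  Submodule.span F {f | ∃ g k, f = (g - freeInvol F g) * (k - freeInvol F k)}

theorem evalStar_sub_freeInvol (hσ : IsTriangularInvolution σ h n χ 1) (a : ℕ → A)
    (f : FreeStar F) : ∃ c : F, evalStar σ a (f - freeInvol F f) = c • h ∧
      c = χ (evalStar σ a (f - freeInvol F f)) := by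
  obtain ⟨b, d, e, hx⟩ := hσ.span (evalStar σ a f)
  have h1 : evalStar σ a (f - freeInvol F f) = (2 * e) • h := by
    rw [map_sub, hσ.evalStar_freeInvol, hx, hσ.map_combination]
    module
  exact ⟨2 * e, h1, by rw [h1, map_smul, hσ.basis.char_h, smul_eq_mul, mul_one]⟩

theorem evalStar_skewProducts (hσ : IsTriangularInvolution σ h n χ 1) {v : FreeStar F}
    (hv : v ∈ skewProducts F) (a : ℕ → A) :
    evalStar σ a v = χ (evalStar σ a v) • (1 : A) := by
  induction hv using Submodule.span_induction with
  | zero => simp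
  | add v v' _ _ hv hv' => rw [map_add, map_add, add_smul, ← hv, ← hv']
  | smul c v _ hv => rw [map_smul, map_smul, smul_assoc, ← hv]
  | mem v hv =>
    obtain ⟨g, k, rfl⟩ := hv
    obtain ⟨c, hc, -⟩ := hσ.evalStar_sub_freeInvol a g
    obtain ⟨d, hd, -⟩ := hσ.evalStar_sub_freeInvol a k
    refine eq_char_smul_one (c := c * d) ?_
    rw [map_mul, hc, hd, smul_mul_smul_comm, hσ.basis.hh]

theorem exists_skewProducts_mul (χ : A →ₐ[F] F) (hF : ringChar F ≠ 2)
    {v : FreeStar F}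
    (hv : v ∈ skewProducts F) (g : FreeStar F) : ∃ v' ∈ skewProducts F, ∀ a,
      χ (evalStar σ a v') = χ (evalStar σ a v) * χ (evalStar σ a (g + freeInvol F g)) := by
  have hfree := freeInvol_isInvolution F
  induction hv using Submodule.span_induction with
  | zero => exact ⟨0, zero_mem _, by simp⟩
  | add v w _ _ hv hw =>
    obtain ⟨v', hv', hv⟩ := hv
    obtain ⟨w', hw', hw⟩ := hw
    exact ⟨v' + w', add_mem hv' hw', fun a => by simp only [map_add] at hv hw ⊢; rw [hv, hw]; ring⟩
  | smul c v _ hv =>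
    obtain ⟨v', hv', hv⟩ := hv
    exact ⟨c • v', Submodule.smul_mem _ _ hv', fun a => by
      simp only [map_smul, smul_eq_mul, map_add] at hv ⊢; rw [hv]; ring⟩
  | mem v hv =>
    obtain ⟨f, k, rfl⟩ := hv
    -- the skew part of the product of a skew and a symmetric polynomial
    set s := g + freeInvol F g with hs
    set m := (k - freeInvol F k) * s with hm
    have hss : freeInvol F s = s := by rw [hs, hfree.map_add, hfree.involutive, add_comm]
    have hneg : freeInvol F (k - freeInvol F k) = -(k - freeInvol F k) := by
      rw [hfree.map_sub, hfree.involutive, neg_sub]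
    have hmm : freeInvol F m = -(s * (k - freeInvol F k)) := by
      rw [hm, hfree.map_mul, hss, hneg, mul_neg]
    refine ⟨(1 / 2 : F) • ((f - freeInvol F f) * (m - freeInvol F m)),
      Submodule.smul_mem _ _ (Submodule.subset_span ⟨f, m, rfl⟩), fun a => ?_⟩
    rw [hmm, sub_neg_eq_add, hm]
    simp only [map_smul, map_mul, map_add (evalStar σ a), map_add χ, smul_eq_mul]
    rw [mul_comm (χ (evalStar σ a s)), ← two_mul, mul_left_comm _ (2 : F), ← mul_assoc, one_div,
      inv_mul_cancel₀ (Ring.two_ne_zero hF), one_mul, mul_assoc]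

/-- Deleting the skew parts of the variables changes the sum of the two diagonal entries by a value
of a combination of products of two skew polynomials. -/
theorem exists_skewProducts_sub (hσ : IsTriangularInvolution σ h n χ 1) (hF : ringChar F ≠ 2)
    (f : FreeStar F) : ∃ v ∈ skewProducts F, ∀ a,
      χ (evalStar σ a (f - starEnd (symHalf F) f)) +
        χ (σ (evalStar σ a (f - starEnd (symHalf F) f))) = χ (evalStar σ a v) := by
  let L : FreeStar F → Prop := fun f => ∃ v ∈ skewProducts F, ∀ a,
    χ (evalStar σ a f) + χ (σ (evalStar σ a f)) = χ (evalStar σ a v)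
  have hadd : ∀ f g, L f → L g → L (f + g) := by
    rintro f g ⟨v, hv, hf⟩ ⟨w, hw, hg⟩
    refine ⟨v + w, add_mem hv hw, fun a => ?_⟩
    rw [map_add, map_add, map_add, hσ.involution.map_add, map_add, map_add, ← hf, ← hg]
    ring
  -- with `f` and `g` split into symmetric and skew parts, the sum of the diagonal entries of
  -- `f * g` comes from the products of the two symmetric and of the two skew parts
  have hmul : ∀ f g, L f → L (f * g) ∧ L (g * f) := by
    rintro f g ⟨v, hv, hf⟩
    obtain ⟨v', hv', hg⟩ := exists_skewProducts_mul (σ := σ) χ hF hv g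
    have h2 : (2 : F) ≠ 0 := Ring.two_ne_zero hF
    have hw : (1 / 2 : F) • (v' + (f - freeInvol F f) * (g - freeInvol F g)) ∈ skewProducts F :=
      Submodule.smul_mem _ _ (add_mem hv' (Submodule.subset_span ⟨f, g, rfl⟩))
    refine ⟨⟨_, hw, fun a => ?_⟩, ⟨_, hw, fun a => ?_⟩⟩ <;>
    · simp only [map_smul, map_add, map_mul, map_sub, hσ.evalStar_freeInvol, smul_eq_mul,
        hσ.involution.map_mul] at hg ⊢
      rw [hg, ← hf]
      field_simp
      ring
  have hσsub := hσ.involution.map_sub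
  change L (f - starEnd (symHalf F) f)
  have hinl : ∀ a i, evalStar σ a (symHalf F i) = (1 / 2 : F) • (a i + σ (a i)) := fun a i => by
    rw [symHalf, map_smul, evalStar_symVar]
  have hσhalf : ∀ x : A, σ ((1 / 2 : F) • (x + σ x)) = (1 / 2 : F) • (x + σ x) := fun x => by
    rw [hσ.linear, hσ.involution.map_add, hσ.involution.involutive, add_comm]
  have hL : ∀ (f : FreeStar F), (∀ a, evalStar σ a f + σ (evalStar σ a f) = 0) → L f := by
    intro f hf
    refine ⟨0, zero_mem _, fun a => ?_⟩
    rw [← map_add, hf, map_zero (evalStar σ a), map_zero χ]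
  induction f using FreeAlgebra.induction with
  | grade0 c =>
    rw [AlgHom.commutes, sub_self]
    refine hL _ fun a => ?_
    rw [map_zero, hσ.involution.map_zero, add_zero]
  | grade1 i =>
    refine hL _ fun a => ?_
    rcases i with i | i
    · rw [map_sub, evalStar_inl, evalStar_inl, hinl, hσsub, hσhalf, sub_add_sub_comm,
        half_add_half hF, sub_self]
    · rw [map_sub, evalStar_inr, evalStar_inr, freeInvol_symHalf, hinl, hσsub, hσhalf,
        sub_add_sub_comm, half_add_half hF, hσ.involution.involutive, add_comm, sub_self]
  | mul f g hf hg =>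
    rw [map_mul, show f * g - starEnd (symHalf F) f * starEnd (symHalf F) g =
      (f - starEnd (symHalf F) f) * g + starEnd (symHalf F) f * (g - starEnd (symHalf F) g) by
        noncomm_ring]
    exact hadd _ _ (hmul _ g hf).1 (hmul _ _ hg).2
  | add f g hf hg =>
    rw [map_add, add_sub_add_comm]
    exact hadd _ _ hf hg

/-- The polynomial in commuting variables underlying `f`, with both `x_i` and `x_i*` replaced
by `X_i`. -/
noncomputable def commPart (F : Type u) [Field F] : FreeStar F →ₐ[F] MvPolynomial ℕ F :=
  FreeAlgebra.lift F (Sum.elim MvPolynomial.X MvPolynomial.X)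

/-- The value of `f` at `α + n` in direction `i` is the first order Taylor expansion of its
commutative polynomial. -/
theorem evalStar_add_single (hσ : IsTriangularInvolution σ h n χ 1) (α : ℕ → F) (i : ℕ)
    (f : FreeStar F) :
    evalStar σ (fun j => α j • (1 : A) + (Pi.single i 1 : ℕ → F) j • n) f =
      MvPolynomial.eval α (commPart F f) • (1 : A) +
      MvPolynomial.eval α (MvPolynomial.pderiv i (commPart F f)) • n := by
  have hfix : ∀ b c : F, σ (b • (1 : A) + c • n) = b • (1 : A) + c • n := fun b c => by
    simpa using hσ.map_combination b c 0
  have hX : ∀ j, MvPolynomial.eval α (MvPolynomial.pderiv i (MvPolynomial.X j)) =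
      (Pi.single i 1 : ℕ → F) j := fun j => by
    rcases eq_or_ne j i with rfl | hj
    · simp
    · simp [MvPolynomial.pderiv_X_of_ne hj, hj]
  induction f using FreeAlgebra.induction with
  | grade0 c => simp [Algebra.algebraMap_eq_smul_one]
  | grade1 j =>
    rcases j with j | j
    · rw [show commPart F (FreeAlgebra.ι F (Sum.inl j)) = MvPolynomial.X j by simp [commPart], hX,
        evalStar_inl, MvPolynomial.eval_X]
    · rw [show commPart F (FreeAlgebra.ι F (Sum.inr j)) = MvPolynomial.X j by simp [commPart], hX,
        evalStar_inr, hfix, MvPolynomial.eval_X]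
  | mul f g hf hg =>
    rw [map_mul, hf, hg]
    simp only [map_mul, Derivation.leibniz, map_add, smul_eq_mul, add_mul, mul_add,
      smul_mul_smul_comm, hσ.basis.nn, one_mul, mul_one, smul_zero]
    module
  | add f g hf hg =>
    rw [map_add, hf, hg]
    simp only [map_add]
    module

/-- The values of the symmetric parts of the variables under `χ`. -/
noncomputable def symChar (σ : A → A) (χ : A →ₐ[F] F) (a : ℕ → A) (i : ℕ) : F :=
  χ ((1 / 2 : F) • (a i + σ (a i)))

theorem evalStar_starEnd_symHalf (hσ : IsTriangularInvolution σ h n χ 1) (a : ℕ → A)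
    (f : FreeStar F) : ∃ β : F, evalStar σ a (starEnd (symHalf F) f) =
      MvPolynomial.eval (symChar σ χ a) (commPart F f) • (1 : A) + β • n := by
  have hgen : ∀ i, ∃ β : F, evalStar σ a (symHalf F i) = symChar σ χ a i • (1 : A) + β • n := by
    intro i
    obtain ⟨b, c, d, hx⟩ := hσ.span (a i)
    have h1 : (1 / 2 : F) • (a i + σ (a i)) =
        ((1 / 2 : F) * (2 * b)) • (1 : A) + ((1 / 2 : F) * (2 * c)) • n := by
      rw [hx, hσ.map_combination]
      module
    refine ⟨(1 / 2 : F) * (2 * c), ?_⟩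
    rw [symHalf, map_smul, evalStar_symVar, symChar, h1]
    simp [hσ.basis.char_n]
  induction f using FreeAlgebra.induction with
  | grade0 c => exact ⟨0, by simp [Algebra.algebraMap_eq_smul_one]⟩
  | grade1 i =>
    rcases i with i | i
    · simpa [commPart, evalStar_inl] using hgen i
    · simpa [commPart, evalStar_inr, freeInvol_symHalf] using hgen i
  | mul f g hf hg =>
    obtain ⟨β, hf⟩ := hf
    obtain ⟨γ, hg⟩ := hg
    refine ⟨MvPolynomial.eval (symChar σ χ a) (commPart F f) * γ +
      MvPolynomial.eval (symChar σ χ a) (commPart F g) * β, ?_⟩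
    rw [map_mul, map_mul, hf, hg]
    simp only [map_mul, add_mul, mul_add, smul_mul_smul_comm, hσ.basis.nn, one_mul, mul_one,
      smul_zero]
    module
  | add f g hf hg =>
    obtain ⟨β, hf⟩ := hf
    obtain ⟨γ, hg⟩ := hg
    refine ⟨β + γ, ?_⟩
    rw [map_add, map_add, hf, hg]
    simp only [map_add]
    module

/-- Since the symmetric elements are `α + β n`, their `p`-th powers are scalars in
characteristic `p`; every `p`-th power of a commutative polynomial arises from such powers. -/
theorem exists_mem_pow_ringChar (hσ : IsTriangularInvolution σ h n χ 1) (hF : ringChar F ≠ 2)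
    {V : Submodule F (FreeStar F)} (hV : IsTStarSpace V) (hsym : symVar F 0 ^ ringChar F ∈ V)
    (R : MvPolynomial ℕ F) : ∃ w ∈ V, ∀ a,
      evalStar σ a w = MvPolynomial.eval (symChar σ χ a) R ^ ringChar F • (1 : A) := by
  obtain ⟨f, rfl⟩ : ∃ f, commPart F f = R := by
    induction R using MvPolynomial.induction_on with
    | C c => exact ⟨algebraMap F _ c, by rw [AlgHom.commutes]; rfl⟩
    | add p q hp hq =>
      obtain ⟨f, rfl⟩ := hp
      obtain ⟨g, rfl⟩ := hq
      exact ⟨f + g, map_add _ _ _⟩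
    | mul_X p i hp =>
      obtain ⟨f, rfl⟩ := hp
      exact ⟨f * FreeAlgebra.ι F (Sum.inl i), by simp [commPart]⟩
  set g := (1 / 2 : F) • starEnd (symHalf F) f with hg
  refine ⟨starEnd (fun _ => g) (symVar F 0 ^ ringChar F), hV _ (isStarEnd_starEnd _) _ hsym,
    fun a => ?_⟩
  obtain ⟨β, hβ⟩ := hσ.evalStar_starEnd_symHalf a f
  have hfix := hσ.map_combination (MvPolynomial.eval (symChar σ χ a) (commPart F f)) β 0
  rw [zero_smul, add_zero, sub_zero, one_mul] at hfix
  rw [map_pow, map_pow, evalStar_symVar, map_add, hσ.evalStar_freeInvol, hg, map_smul, hβ,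
    hσ.linear, hfix, half_add_half hF, smul_one_add_smul_pow hσ.basis, CharP.cast_eq_zero,
    zero_mul, zero_mul, zero_smul, add_zero]

/-- A polynomial whose partial derivatives vanish as functions on `F` is, as a function, a
combination of `p`-th powers, where `p` is the characteristic of `F`. -/
theorem exists_pow_ringChar_of_pderiv {P : MvPolynomial ℕ F}
    (hP : ∀ α i, MvPolynomial.eval α (MvPolynomial.pderiv i P) = 0) {m : ℕ →₀ ℕ}
    (hm : m ∈ P.support) : ∃ R : MvPolynomial ℕ F, ∀ α,
      MvPolynomial.eval α (MvPolynomial.monomial m 1) = MvPolynomial.eval α R ^ ringChar F := by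
  rcases finite_or_infinite F with hfin | hinf
  · have := Fintype.ofFinite F
    obtain ⟨e, hp, hcard⟩ := FiniteField.card F (ringChar F)
    refine ⟨MvPolynomial.monomial m 1 ^ ringChar F ^ ((e : ℕ) - 1), fun α => ?_⟩
    rw [map_pow, ← pow_mul, ← pow_succ, Nat.sub_add_cancel e.pos, ← hcard, FiniteField.pow_card]
  · have hdvd : ∀ i, ringChar F ∣ m i := by
      intro i
      have h0 : MvPolynomial.pderiv i P = 0 := MvPolynomial.funext fun α => by simpa using hP α i
      by_cases hi : m i = 0
      · rw [hi]; exact dvd_zero _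
      have h1 := MvPolynomial.coeff_pderiv (i := i) P (m - Finsupp.single i 1)
      have hle : Finsupp.single i 1 ≤ m := Finsupp.single_le_iff.2 (Nat.one_le_iff_ne_zero.2 hi)
      rw [h0, MvPolynomial.coeff_zero, tsub_add_cancel_of_le hle] at h1
      have h2 := (mul_eq_zero.1 h1.symm).resolve_left (MvPolynomial.mem_support_iff.1 hm)
      rw [← ringChar.spec]
      simpa [Nat.cast_sub (Nat.one_le_iff_ne_zero.2 hi)] using h2
    choose d hd using hdvd
    refine ⟨MvPolynomial.monomial (m.mapRange (· / ringChar F) (Nat.zero_div _)) 1, fun α => ?_⟩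
    rw [MvPolynomial.eval_monomial, MvPolynomial.eval_monomial, one_mul, one_mul,
      Finsupp.prod_mapRange_index (by simp), Finsupp.prod, Finsupp.prod, ← Finset.prod_pow]
    refine Finset.prod_congr rfl fun i _ => ?_
    rw [← pow_mul, Nat.div_mul_cancel ⟨d i, hd i⟩]

theorem isFG_of_plus (hσ : IsTriangularInvolution σ h n χ 1) (hF : ringChar F ≠ 2) :
    IsFGTStarSpace (starCentral F σ) ∧
      starCentral F σ ≠ starIdentities F σ ⊔ scalars F := by
  obtain ⟨r, hr⟩ := exists_isReducedExponent hF
  have h2 : (2 : F) ≠ 0 := Ring.two_ne_zero hF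
  have hId := hσ.starIdentities_eq_of_plus hF hr
  set W := relationGenerators F (fun {_} _ y z => plusRelations r y z)
  have hskew : skewVar F 0 * skewVar F 1 ∈ skewProducts F :=
    Submodule.subset_span ⟨FreeAlgebra.ι F (Sum.inl 0), FreeAlgebra.ι F (Sum.inl 1), by
      rw [freeInvol_x, freeInvol_x, skewVar, skewVar]⟩
  have hskewC : skewVar F 0 * skewVar F 1 ∈ starCentral F σ := by
    rw [hσ.mem_starCentral_iff hF]
    exact hσ.evalStar_skewProducts hskew
  have hsymC : symVar F 0 ^ ringChar F ∈ starCentral F σ := by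
    rw [hσ.mem_starCentral_iff hF]
    intro a
    obtain ⟨c, d, e, hx⟩ := hσ.span (a 0)
    refine eq_char_smul_one (c := (2 * c) ^ ringChar F) ?_
    have h1 : evalStar σ a (symVar F 0) = (2 * c) • (1 : A) + (2 * d) • n := by
      rw [evalStar_symVar, hx, hσ.map_combination]
      module
    rw [map_pow, h1, smul_one_add_smul_pow hσ.basis, CharP.cast_eq_zero, zero_mul, zero_mul,
      zero_smul, add_zero]
  refine ⟨⟨hσ.isTStarSpace_starCentral,
    W ∪ {symVar F 0 ^ ringChar F, skewVar F 0 * skewVar F 1},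
    (relationGenerators_finite _).union (Set.toFinite _), le_antisymm ?_ ?_⟩, ?_⟩
  · intro f hf
    set V := tStarSpan (W ∪ {symVar F 0 ^ ringChar F, skewVar F 0 * skewVar F 1})
    have hT : IsTStarSpace V := isTStarSpace_tStarSpan _
    have hIdV : starIdentities F σ ≤ V := by
      rw [hId]
      exact tStarSpan_le hT fun g hg => subset_tStarSpan _ (Or.inl hg)
    have hsymV : symVar F 0 ^ ringChar F ∈ V := subset_tStarSpan _ (Or.inr (Or.inl rfl))
    have hprodV : skewProducts F ≤ V := by
      refine Submodule.span_le.2 ?_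
      rintro _ ⟨g, k, rfl⟩
      have := hT (starEnd fun i => if i = 0 then g else k) (isStarEnd_starEnd _) _
        (subset_tStarSpan _ (Or.inr (Or.inr rfl)))
      rw [map_mul, evalStar_skewVar, evalStar_skewVar, if_pos rfl, if_neg one_ne_zero] at this
      exact this
    -- it suffices to find an element of `V` with the values of `f`
    suffices hw : ∃ w ∈ V, ∀ a, evalStar σ a f = evalStar σ a w by
      obtain ⟨w, hw, hfw⟩ := hw
      rw [← sub_add_cancel f w]
      exact add_mem (hIdV (sub_mem_starIdentities hfw)) hw
    have hC := (hσ.mem_starCentral_iff hF f).1 hf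
    have hΘC := (hσ.mem_starCentral_iff hF _).1
      (hσ.isTStarSpace_starCentral _ (isStarEnd_starEnd (symHalf F)) f hf)
    obtain ⟨v, hv, hfv⟩ := hσ.exists_skewProducts_sub hF f
    -- the part of `f` in the symmetric variables has the values of its commutative polynomial
    have hder : ∀ α i, MvPolynomial.eval α (MvPolynomial.pderiv i (commPart F f)) = 0 := by
      intro α i
      have h1 := hC fun j => α j • (1 : A) + (Pi.single i 1 : ℕ → F) j • n
      rw [hσ.evalStar_add_single, map_add, map_smul, map_smul, map_one, hσ.basis.char_n, smul_zero,
        add_zero, smul_eq_mul, mul_one, add_eq_left, smul_eq_zero_iff_left hσ.basis.ne_zero] at h1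
      exact h1
    have hΘ : ∀ a, evalStar σ a (starEnd (symHalf F) f) =
        MvPolynomial.eval (symChar σ χ a) (commPart F f) • (1 : A) := by
      intro a
      obtain ⟨β, hβ⟩ := hσ.evalStar_starEnd_symHalf a f
      rw [hΘC, hβ, map_add, map_smul, map_smul, map_one, hσ.basis.char_n, smul_zero, add_zero,
        smul_eq_mul, mul_one]
    have hR : ∀ m ∈ (commPart F f).support, ∃ w ∈ V, ∀ a, evalStar σ a w =
        MvPolynomial.eval (symChar σ χ a) (MvPolynomial.monomial m 1) • (1 : A) := by
      intro m hm
      obtain ⟨R, hR⟩ := exists_pow_ringChar_of_pderiv hder hm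
      obtain ⟨w, hw, hwR⟩ := hσ.exists_mem_pow_ringChar hF hT hsymV R
      exact ⟨w, hw, fun a => by rw [hwR, hR]⟩
    choose! w hwV hw using hR
    refine ⟨(1 / 2 : F) • v + ∑ m ∈ (commPart F f).support, (commPart F f).coeff m • w m,
      add_mem (Submodule.smul_mem _ _ (hprodV hv))
        (sum_mem fun m hm => Submodule.smul_mem _ _ (hwV m hm)), fun a => ?_⟩
    have hsum : evalStar σ a (∑ m ∈ (commPart F f).support, (commPart F f).coeff m • w m) =
        evalStar σ a (starEnd (symHalf F) f) := by
      rw [hΘ]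
      conv_rhs => rw [(commPart F f).as_sum]
      rw [map_sum, map_sum, Finset.sum_smul]
      refine Finset.sum_congr rfl fun m hm => ?_
      rw [map_smul, hw m hm, smul_smul]
      simp [MvPolynomial.eval_monomial]
    rw [map_add, hsum, map_smul, hσ.evalStar_skewProducts hv, ← hfv, map_sub, hC a, hΘC a,
      ← sub_smul, hσ.linear, hσ.involution.map_one, map_smul, map_one, smul_eq_mul, mul_one,
      ← smul_assoc, smul_add, half_add_half hF]
    module
  · refine tStarSpan_le hσ.isTStarSpace_starCentral ?_
    rintro f (hf | rfl | rfl)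
    · exact starIdentities_le_starCentral (hId ▸ subset_tStarSpan W hf)
    · exact hsymC
    · exact hskewC
  · refine starCentral_ne hskewC (a := fun _ => 0) (b := fun _ => h) ?_ ?_
    · rw [map_mul, evalStar_skewVar, hσ.involution.map_zero, sub_self, zero_mul]
    · rw [map_mul, evalStar_skewVar, evalStar_skewVar, hσ.map_h]
      intro h0
      have := congrArg χ h0
      rw [map_mul, map_sub, map_neg, hσ.basis.char_h, map_zero] at this
      ring_nf at this
      exact mul_ne_zero h2 h2 (by linear_combination this)

end Plus

end IsTriangularInvolution

end StarPoly

/-! ### Involutions of the first kind on the upper triangular matrices -/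

namespace StarPoly

universe u

namespace UT2

variable {F : Type u} [Field F]

theorem entry_one_zero (x : UT2 F) : x.1 1 0 = 0 := x.2 (by decide)

theorem ext {x y : UT2 F} (h0 : x.1 0 0 = y.1 0 0) (h1 : x.1 0 1 = y.1 0 1)
    (h2 : x.1 1 1 = y.1 1 1) : x = y := by
  refine Subtype.ext (Matrix.ext fun i j => ?_)
  fin_cases i <;> fin_cases j
  · exact h0
  · exact h1
  · exact (entry_one_zero x).trans (entry_one_zero y).symm
  · exact h2

theorem mul_00 (x y : UT2 F) : (x * y).1 0 0 = x.1 0 0 * y.1 0 0 := by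
  simp [Matrix.mul_apply, Fin.sum_univ_two, entry_one_zero y]

theorem mul_01 (x y : UT2 F) :
    (x * y).1 0 1 = x.1 0 0 * y.1 0 1 + x.1 0 1 * y.1 1 1 := by
  simp [Matrix.mul_apply, Fin.sum_univ_two]

theorem mul_11 (x y : UT2 F) : (x * y).1 1 1 = x.1 1 1 * y.1 1 1 := by
  simp [Matrix.mul_apply, Fin.sum_univ_two, entry_one_zero x]

/-- The upper triangular matrix with diagonal entries `a`, `c` and off-diagonal entry `b`. -/
def mk (a b c : F) : UT2 F := ⟨!![a, b; 0, c], by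
  intro i j hij
  fin_cases i <;> fin_cases j <;> simp at hij ⊢⟩

@[simp] theorem mk_00 (a b c : F) : (mk a b c).1 0 0 = a := rfl

@[simp] theorem mk_01 (a b c : F) : (mk a b c).1 0 1 = b := rfl

@[simp] theorem mk_11 (a b c : F) : (mk a b c).1 1 1 = c := rfl

/-- The upper left entry, as a character. -/
def char (F : Type u) [Field F] : UT2 F →ₐ[F] F where
  toFun x := x.1 0 0
  map_one' := by simp
  map_mul' := mul_00
  map_zero' := by simp
  map_add' x y := by simp
  commutes' c := by simp [Algebra.algebraMap_eq_smul_one]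

theorem char_apply (x : UT2 F) : char F x = x.1 0 0 := rfl

end UT2

variable {F : Type u} [Field F] {σ : UT2 F → UT2 F}

theorem IsInvolutionFirstKind.smul (hσ : IsInvolutionFirstKind σ) (c : F) (a : UT2 F) :
    σ (c • a) = c • σ a := by
  have hc : algebraMap F (UT2 F) c ∈ Set.center (UT2 F) :=
    Semigroup.mem_center_iff.2 fun g => (Algebra.commutes c g).symm
  rw [Algebra.smul_def, hσ.map_mul, hσ.map_center _ hc, Algebra.smul_def, Algebra.commutes]

/-- Every involution of the first kind interchanges the two diagonal entries, is diagonal in a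
suitable basis, and either fixes or negates `e₁₂`. -/
theorem IsInvolutionFirstKind.exists_isTriangularInvolution (hF : ringChar F ≠ 2)
    (hσ : IsInvolutionFirstKind σ) : ∃ (h n : UT2 F) (χ : UT2 F →ₐ[F] F) (ε : F),
      (ε = 1 ∨ ε = -1) ∧ IsTriangularInvolution σ h n χ ε := by
  have h2 : (2 : F) ≠ 0 := Ring.two_ne_zero hF
  have hone := hσ.toIsInvolution.map_one
  set n : UT2 F := UT2.mk 0 1 0 with hn
  set e : UT2 F := UT2.mk 1 0 0 with he
  have hn0 : n ≠ 0 := fun h0 => by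
    have := congrArg (fun x : UT2 F => x.1 0 1) h0
    simp [hn] at this
  -- `σ n` has square zero
  obtain ⟨t, ht⟩ : ∃ t : F, σ n = t • n := by
    have hsq : σ n * σ n = 0 := by
      rw [← hσ.map_mul, ← hσ.toIsInvolution.map_zero]
      congr 1
      refine UT2.ext ?_ ?_ ?_ <;> simp [UT2.mul_00, UT2.mul_01, UT2.mul_11, hn]
    have h0 := congrArg (fun x : UT2 F => x.1 0 0) hsq
    have h1 := congrArg (fun x : UT2 F => x.1 1 1) hsq
    simp only [UT2.mul_00, UT2.mul_11] at h0 h1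
    refine ⟨(σ n).1 0 1, UT2.ext ?_ ?_ ?_⟩
    · simpa [hn] using h0
    · simp [hn]
    · simpa [hn] using h1
  have htt : t * t = 1 := by
    have h0 := hσ.involutive n
    rw [ht, hσ.smul, ht, smul_smul] at h0
    have h1 := congrArg (fun x : UT2 F => x.1 0 1) h0
    simpa [hn] using h1
  have ht0 : t ≠ 0 := fun h0 => by simp [h0] at htt
  -- `e * n = n` and `n * e = 0` determine the diagonal of `σ e`
  obtain ⟨s, hs⟩ : ∃ s : F, σ e = s • n + (1 - e) := by
    have hen : e * n = n := by
      refine UT2.ext ?_ ?_ ?_ <;> simp [UT2.mul_00, UT2.mul_01, UT2.mul_11, hn, he]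
    have hne : n * e = 0 := by
      refine UT2.ext ?_ ?_ ?_ <;> simp [UT2.mul_00, UT2.mul_01, UT2.mul_11, hn, he]
    have h0 := hσ.map_mul e n
    rw [hen, ht] at h0
    have h1 := hσ.map_mul n e
    rw [hne, ht, hσ.toIsInvolution.map_zero] at h1
    have h3 := congrArg (fun x : UT2 F => x.1 0 1) h0
    have h4 := congrArg (fun x : UT2 F => x.1 0 1) h1
    simp only [UT2.mul_01] at h3 h4
    simp [hn, ht0] at h3 h4
    refine ⟨(σ e).1 0 1, UT2.ext ?_ ?_ ?_⟩
    · simpa [hn, he] using h4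
    · simp [hn, he]
    · simpa [hn, he] using h3
  have hst : s * t = s := by
    have h0 := hσ.involutive e
    rw [hs, hσ.map_add, hσ.smul, ht, hσ.toIsInvolution.map_sub, hone, hs] at h0
    have h1 := congrArg (fun x : UT2 F => x.1 0 1) h0
    simp [hn, he] at h1
    linear_combination h1
  refine ⟨(2 : F) • e - 1 - s • n, n, UT2.char F, t, ?_, ?_⟩
  · have h0 : (t - 1) * (t + 1) = 0 := by linear_combination htt
    rcases mul_eq_zero.1 h0 with h0 | h0
    · exact Or.inl (sub_eq_zero.1 h0)
    · exact Or.inr (eq_neg_of_add_eq_zero_left h0)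
  refine ⟨⟨?_, ?_, ?_, ?_, hn0, ?_, ?_, ?_⟩, hσ.toIsInvolution, hσ.smul, ?_, ?_, ht⟩
  · refine UT2.ext ?_ ?_ ?_ <;> simp [UT2.mul_00, UT2.mul_01, UT2.mul_11, hn, he] <;> ring
  · refine UT2.ext ?_ ?_ ?_ <;> simp [UT2.mul_00, UT2.mul_01, UT2.mul_11, hn, he]
    ring
  · refine UT2.ext ?_ ?_ ?_ <;> simp [UT2.mul_00, UT2.mul_01, UT2.mul_11, hn, he]
  · refine UT2.ext ?_ ?_ ?_ <;> simp [UT2.mul_00, UT2.mul_01, UT2.mul_11, hn]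
  · intro x
    refine UT2.ext ?_ ?_ ?_ <;>
      simp [UT2.mul_00, UT2.mul_01, UT2.mul_11, hn, UT2.char_apply]
  · simp [UT2.char_apply, hn, he]
    ring
  · simp [UT2.char_apply, hn]
  · intro x
    refine ⟨(x.1 0 0 + x.1 1 1) / 2, x.1 0 1 + s * ((x.1 0 0 - x.1 1 1) / 2),
      (x.1 0 0 - x.1 1 1) / 2, UT2.ext ?_ ?_ ?_⟩ <;> simp [hn, he] <;> field_simp <;> ring
  · rw [hσ.toIsInvolution.map_sub, hσ.toIsInvolution.map_sub, hσ.smul, hσ.smul, hone, hs, ht,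
      smul_smul, hst]
    module

end StarPoly

theorem mainTheorem5 {F : Type*} [Field F] (hF : ringChar F ≠ 2)
    (σ : StarPoly.UT2 F → StarPoly.UT2 F) (hσ : StarPoly.IsInvolutionFirstKind σ) :
    StarPoly.IsFGTStarSpace (StarPoly.starCentral F σ) ∧
      StarPoly.starCentral F σ ≠ StarPoly.starIdentities F σ ⊔ StarPoly.scalars F := by
  obtain ⟨h, n, χ, ε, rfl | rfl, hε⟩ := hσ.exists_isTriangularInvolution hF
  · exact hε.isFG_of_plus hF
  · exact hε.isFG_of_minus hF
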